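/- **Setting.** For a finite set $A$ and $d\ge 0$, let $A^{\mathbb Z^d}$ carry the distance $d_C(x,y)=2^{-\min\{\|i\|_\infty \,:\, x_i\neq y_i\}}$ (and $d_C(x,x)=0$). A cellular automaton (CA) is a map $G:A^{\mathbb Z^d}\to A^{\mathbb Z^d}$ of the form $G(x)(m)=f\big((x(m+u))_{u\in N}\big)$ with $N\subset\mathbb Z^d$ finite and $f:A^N\to A$. A point $x$ is an *equicontinuous point* of $G$ if for all $\epsilon>0$ there is $\delta>0$ such that for every $y$ with $d_C(x,y)<\delta$ one has $d_C(G^n(x),G^n(y))<\epsilon$ for all $n\in\mathbb N$. $G$ is *sensitive* if there is $\epsilon>0$ such that for all $\delta>0$ and all $x$ there are $y$ and $n\in\mathbb N$ with $d_C(x,y)<\delta$ and $d_C(G^n(x),G^n(y))>\epsilon$. **The automaton.** Let $\mathcal A=\mathcal L\cup\mathcal S$ with liquid states $\mathcal L=\{U,D,0\}$ and solid states $\mathcal S=\{1,\downarrow,\uparrow,\leftarrow,\rightarrow,\swarrow,\searrow,\nwarrow,\nearrow\}$. Call a $3\times3$ pattern *allowed* if it occurs as a $3\times 3$ sub-array of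 $$\begin{matrix} \mathcal L&\mathcal L&\mathcal L&\mathcal L&\mathcal L&\mathcal L&\mathcal L&\mathcal L&\mathcal L&\mathcal L\\ \mathcal L&\mathcal L&\mathcal L&\mathcal L&\mathcal L&\mathcal L&\mathcal L&\mathcal L&\mathcal L&\mathcal L\\ \mathcal L&\mathcal L&\mathcal L&\searrow&\downarrow&\downarrow&\downarrow&\swarrow&\mathcal L&\mathcal L\\ \mathcal L&\mathcal L&\mathcal L&\rightarrow&1&1&1&\leftarrow&\mathcal L&\mathcal L\\ \mathcal L&\mathcal L&\mathcal L&\rightarrow&1&1&1&\leftarrow&\mathcal L&\mathcal L\\ \mathcal L&\mathcal L&\mathcal L&\rightarrow&1&1&1&\leftarrow&\mathcal L&\mathcal L\\ \mathcal L&\mathcal L&\mathcal L&\nearrow&\uparrow&\uparrow&\uparrow&\nwarrow&\mathcal L&\mathcal L\\ \mathcal L&\mathcal L&\mathcal L&\mathcal L&\mathcal L&\mathcal L&\mathcal L&\mathcal L&\mathcal L&\mathcal L\\ \mathcal L&\mathcal L&\mathcal L&\mathcal L&\mathcal L&\mathcal L&\mathcal L&\mathcal L&\mathcal L&\mathcal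 L \end{matrix}$$ where each $\mathcal L$ may be filled by any liquid state. The CA $F$ on $\mathcal A^{\mathbb Z^2}$ has the radius-2 Moore ($5\times5$) neighbourhood; the new state of a cell is determined as follows (arrays are drawn with north at the top). 1. If the $5\times5$ neighbourhood contains a $3\times3$ sub-array that is not allowed, the new state is $0$. 2. Otherwise, look at the $3\times3$ neighbourhood, written row by row from north to south and separated by bars; a set stands for any of its elements, $z=\{0\}\cup\mathcal S$, $z_D=\{0,D\}\cup\mathcal S$ and $z_U=\{0,U\}\cup\mathcal S$. * The (solid) central state is kept if the neighbourhood is of the form $\mathcal{LLL}\,|\,\mathcal{SSL}\,|\,\mathcal{SSL}$ or $\mathcal{SSL}\,|\,\mathcal{SSL}\,|\,\mathcal{SSL}$, up to a rotation by a multiple of $\pi/2$, or $\mathcal{SSS}\,|\,\mathcal{SSS}\,|\,\mathcal{SSS}$. * The new state is $U$ if the neighbourhood is of one of the forms $z00|\mathcal S00|\mathcal SU0$; $\;000|000|\mathcal SU0$; $\;000|00U|\mathcal S\mathcal S z_D$; $\;000|00U|0z\mathcal S$; $\;0Uz|00\mathcal S|00\mathcal S$; $\;0U\mathcal S|00\mathcal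 S|00D$; $\;zzz|z0U|zzD$. * The new state is $D$ if the neighbourhood is of one of the forms $\mathcal SD0|\mathcal S00|z00$; $\;\mathcal SD0|000|000$; $\;\mathcal S\mathcal S z_U|00D|000$; $\;0z\mathcal S|00D|000$; $\;00\mathcal S|00\mathcal S|0Dz$; $\;00U|00\mathcal S|0D\mathcal S$; $\;zzU|z0D|zzz$. (These forms are mutually exclusive for different outcomes.) 3. In all other cases the new state is $0$. **Proposition.** $F$ is a two-dimensional cellular automaton with $12$ states and radius-$2$ Moore neighbourhood; it has no equicontinuous point, and it is not sensitive to initial conditions. Consequently the dichotomy "every cellular automaton has an equicontinuous point or is sensitive", which is Kůrka's theorem in dimension $1$, fails in dimension $2$. -/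

import Mathlib

/-! ## Cellular automata on `ℤ^d` and their topological dynamics -/

/-- Configurations: `A`-valued colourings of the cells of `ℤ^d`. -/
abbrev Config (d : ℕ) (A : Type*) : Type _ := (Fin d → ℤ) → A

/-- The sup norm of a cell, as a natural number. -/
def cellNorm {d : ℕ} (i : Fin d → ℤ) : ℕ := Finset.univ.sup fun k => (i k).natAbs

open Classical in
/-- The Cantor distance `2 ^ (- min {‖i‖∞ : x i ≠ y i})` (and `0` when `x = y`). -/
noncomputable def cantorDist {d : ℕ} {A : Type*} (x y : Config d A) : ℝ :=
  if x = y then 0 else (1 / 2 : ℝ) ^ sInf {n : ℕ | ∃ i, x i ≠ y i ∧ cellNorm i = n}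

/-- `F` is a cellular automaton with neighbourhood `N`: it applies synchronously, in every cell,
one local rule to the states found in the cells of the translated neighbourhood. -/
def IsCAWithNeighbourhood {d : ℕ} {A : Type*} (N : Finset (Fin d → ℤ))
    (F : Config d A → Config d A) : Prop :=
  ∃ f : (N → A) → A, ∀ (x : Config d A) (m : Fin d → ℤ), F x m = f fun u => x (m + u)

/-- `F` is a cellular automaton: there is some finite neighbourhood. -/
def IsCA {d : ℕ} {A : Type*} (F : Config d A → Config d A) : Prop :=
  ∃ N : Finset (Fin d → ℤ), IsCAWithNeighbourhood N F

/-- `x` is an equicontinuous point of `F` for the Cantor distance. -/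
def IsEquicontinuousPoint {d : ℕ} {A : Type*} (F : Config d A → Config d A)
    (x : Config d A) : Prop :=
  ∀ ε : ℝ, 0 < ε → ∃ δ : ℝ, 0 < δ ∧ ∀ y : Config d A, cantorDist x y < δ →
    ∀ n : ℕ, cantorDist (F^[n] x) (F^[n] y) < ε

/-- `F` is sensitive to initial conditions for the Cantor distance. -/
def IsSensitive {d : ℕ} {A : Type*} (F : Config d A → Config d A) : Prop :=
  ∃ ε : ℝ, 0 < ε ∧ ∀ δ : ℝ, 0 < δ → ∀ x : Config d A, ∃ (y : Config d A) (n : ℕ),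
    cantorDist x y < δ ∧ ε < cantorDist (F^[n] x) (F^[n] y)

/-- The dichotomy in dimension `d`: every cellular automaton on `ℤ^d` (with a finite state set)
has an equicontinuous point or is sensitive to initial conditions. -/
def KurkaDichotomy (d : ℕ) : Prop :=
  ∀ (A : Type) [Finite A] (F : Config d A → Config d A), IsCA F →
    (∃ x, IsEquicontinuousPoint F x) ∨ IsSensitive F

/-! ## The erosion / infiltration automaton -/

namespace ErosionCA

/-- The 12 states: `U`, `D`, `0`, `1` and the eight arrows
(`dr` is the arrow pointing down and to the right, and so on). -/
inductive State : Type
  | U | D | zero | one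
  | down | up | left | right
  | dl | dr | ul | ur
  deriving DecidableEq

instance : Fintype State where
  elems := {.U, .D, .zero, .one, .down, .up, .left, .right, .dl, .dr, .ul, .ur}
  complete := fun x => by cases x <;> decide

/-- The liquid states `U`, `D`, `0`. -/
def Liq : Finset State := {.U, .D, .zero}

/-- The solid states: `1` and the eight arrows. -/
def Sol : Finset State :=
  {.one, .down, .up, .left, .right, .dl, .dr, .ul, .ur}

/-- A `3 × 3` block of states; row `0` is the northern row, column `0` the western column. -/
abbrev Block : Type := Matrix (Fin 3) (Fin 3) State

/-- A `3 × 3` pattern: in each cell, the set of the states that are accepted there. -/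
abbrev Pattern : Type := Matrix (Fin 3) (Fin 3) (Finset State)

/-- The block `b` matches the pattern `P`. -/
def Fits (P : Pattern) (b : Block) : Prop := ∀ i j, b i j ∈ P i j

instance (P : Pattern) (b : Block) : Decidable (Fits P b) :=
  have (i : Fin 3) : Decidable (∀ j, b i j ∈ P i j) := inferInstance
  inferInstanceAs (Decidable (∀ i j, b i j ∈ P i j))

/-- The `3 × 3` sub-array of an array, with north-western entry in row `i`, column `j`. -/
def sub3 {m n : ℕ} {α : Type} (w : Matrix (Fin (m + 2)) (Fin (n + 2)) α) (i : Fin m) (j : Fin n) :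
    Matrix (Fin 3) (Fin 3) α :=
  fun a b => w ⟨i + a, by omega⟩ ⟨j + b, by omega⟩

/-- A well-formed solid obstacle in a liquid environment. -/
def obstacle : Matrix (Fin 9) (Fin 10) (Finset State) :=
  let l := Liq
  !![l, l, l, l, l, l, l, l, l, l;
     l, l, l, l, l, l, l, l, l, l;
     l, l, l, {.dr}, {.down}, {.down}, {.down}, {.dl}, l, l;
     l, l, l, {.right}, {.one}, {.one}, {.one}, {.left}, l, l;
     l, l, l, {.right}, {.one}, {.one}, {.one}, {.left}, l, l;
     l, l, l, {.right}, {.one}, {.one}, {.one}, {.left}, l, l;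
     l, l, l, {.ur}, {.up}, {.up}, {.up}, {.ul}, l, l;
     l, l, l, l, l, l, l, l, l, l;
     l, l, l, l, l, l, l, l, l, l]

/-- The allowed `3 × 3` blocks: those that appear in `obstacle`, each occurrence of the liquid
component being filled with an arbitrary liquid state. -/
def Allowed (b : Block) : Prop :=
  ∃ (i : Fin 7) (j : Fin 8), Fits (sub3 (m := 7) (n := 8) obstacle i j) b

instance (b : Block) : Decidable (Allowed b) :=
  inferInstanceAs (Decidable (∃ (i : Fin 7) (j : Fin 8),
    Fits (sub3 (m := 7) (n := 8) obstacle i j) b))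

/-- The counterclockwise rotation of a pattern by a right angle. -/
def rot (P : Pattern) : Pattern := fun i j => P j (Fin.rev i)

/-- The pattern and its rotations by the multiples of a right angle. -/
def rotations (P : Pattern) : List Pattern := [P, rot P, rot (rot P), rot (rot (rot P))]

/-- The neighbourhoods in which a solid state (the central one) is kept: those of a corner,
of a side, and of an inner cell of an obstacle. -/
def keepPatterns : List Pattern :=
  let l := Liq
  let s := Sol
  rotations !![l, l, l; s, s, l; s, s, l] ++
  rotations !![s, s, l; s, s, l; s, s, l] ++
  [!![s, s, s; s, s, s; s, s, s]]

/-- The neighbourhoods in which the central cell, in state `0`, becomes `U`. -/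
def toU : List Pattern :=
  let o : Finset State := {.zero}
  let s := Sol
  let u : Finset State := {.U}
  let d : Finset State := {.D}
  let os := o ∪ s
  [!![os, o, o; s, o, o; s, u, o],
   !![o, o, o; o, o, o; s, u, o],
   !![o, o, o; o, o, u; s, s, o ∪ d ∪ s],
   !![o, o, o; o, o, u; o, os, s],
   !![o, u, os; o, o, s; o, o, s],
   !![o, u, s; o, o, s; o, o, d],
   !![os, os, os; os, o, u; os, os, d]]

/-- The neighbourhoods in which the central cell, in state `0`, becomes `D`. -/
def toD : List Pattern :=
  let o : Finset State := {.zero}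
  let s := Sol
  let u : Finset State := {.U}
  let d : Finset State := {.D}
  let os := o ∪ s
  [!![s, d, o; s, o, o; os, o, o],
   !![s, d, o; o, o, o; o, o, o],
   !![s, s, o ∪ u ∪ s; o, o, d; o, o, o],
   !![o, os, s; o, o, d; o, o, o],
   !![o, o, s; o, o, s; o, d, os],
   !![o, o, u; o, o, s; o, d, s],
   !![os, os, u; os, o, d; os, os, os]]

/-- The local rule, as a function of the `5 × 5` neighbourhood (row `0` is the northern row).
The three kinds of neighbourhoods of the `else` part are pairwise exclusive, so that the order in
which they are tried does not matter. -/
def localRule (w : Matrix (Fin 5) (Fin 5) State) : State :=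
  if ∃ i j : Fin 3, ¬ Allowed (sub3 (m := 3) (n := 3) w i j) then .zero
  else
    let b : Block := sub3 (m := 3) (n := 3) w 1 1
    if ∃ P ∈ keepPatterns, Fits P b then b 1 1
    else if ∃ P ∈ toU, Fits P b then .U
    else if ∃ P ∈ toD, Fits P b then .D
    else .zero

/-- The global map: the first coordinate of a cell increases to the east, the second one to the
north. -/
def step (x : Config 2 State) : Config 2 State :=
  fun z => localRule fun r c => x (z + ![(c : ℤ) - 2, 2 - (r : ℤ)])

end ErosionCA

/-! ## The Cantor distance -/

/-! Sensitivity fails because a large well-formed square protects itself. Its cells see only allowed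
blocks as long as the cells around it are liquid, and liquid never solidifies, so the square
survives whatever happens outside. Two orbits that start with the same large square therefore agree
forever in its interior (`HasSquare.iterate`).

For the absence of equicontinuous points, replace a point `x` by `0` outside a ball. Forbidden
blocks erode the finitely many solid cells until a stable configuration remains
(`exists_allAllowed_iterate`), whose obstacles are frozen, well-separated rectangles
(`AllAllowed.exists_isObstacle`). The remaining particles drift west, by a potential argument
(`AllAllowed.U_escapes`).

Through the quiet configuration that is left, a vertical pair `U` over `D` travels west. At an
obstacle it splits, `U` passing north and `D` south, and it forms again on the other side. The
journey can be traced back to the far east from any two vertically adjacent liquid cells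
(`exists_iterate_pair`). A pair that starts far enough away lies outside the ball and arrives after
the old particles have gone, so it disturbs a liquid cell that would otherwise be `0`
(`exists_infiltration`).

The disturbed cell must lie in a window fixed before the ball is chosen. The arrows of `x` provide
it: an obstacle made of states of `x` must end in the east at an arrow with a western component, so
the row of the origin becomes liquid within a distance that depends on `x` only (`exists_window`).
-/

theorem cantorDist_le_of_agree {d : ℕ} {A : Type*} {x y : Config d A} {m : ℕ}
    (h : ∀ i, cellNorm i ≤ m → x i = y i) : cantorDist x y ≤ (1 / 2 : ℝ) ^ (m + 1) := by
  unfold cantorDist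
  split_ifs with hxy
  · positivity
  · have hne : {n : ℕ | ∃ i, x i ≠ y i ∧ cellNorm i = n}.Nonempty := by
      obtain ⟨i, hi⟩ := Function.ne_iff.mp hxy
      exact ⟨_, i, hi, rfl⟩
    obtain ⟨i, hi, hn⟩ := Nat.sInf_mem hne
    refine pow_le_pow_of_le_one (by norm_num) (by norm_num) ?_
    rw [← hn]
    by_contra hlt
    exact hi (h i (by omega))

theorem agree_of_cantorDist_lt {d : ℕ} {A : Type*} {x y : Config d A} {m : ℕ}
    (h : cantorDist x y < (1 / 2 : ℝ) ^ m) {i : Fin d → ℤ} (hi : cellNorm i ≤ m) :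
    x i = y i := by
  by_contra hne
  have hxy : x ≠ y := fun e => hne (by rw [e])
  rw [cantorDist, if_neg hxy] at h
  have : sInf {n : ℕ | ∃ i, x i ≠ y i ∧ cellNorm i = n} ≤ m :=
    (Nat.sInf_le (show cellNorm i ∈ {n : ℕ | ∃ i, x i ≠ y i ∧ cellNorm i = n} from
      ⟨i, hne, rfl⟩)).trans hi
  exact absurd h (not_lt.mpr (pow_le_pow_of_le_one (by norm_num) (by norm_num) this))

theorem cellNorm_le_iff {m : ℕ} {a b : ℤ} :
    cellNorm ![a, b] ≤ m ↔ a.natAbs ≤ m ∧ b.natAbs ≤ m := by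
  simp [cellNorm, Finset.sup_le_iff, Fin.forall_fin_two]

theorem eq_cons (m : Fin 2 → ℤ) : m = ![m 0, m 1] := by
  ext i; fin_cases i <;> rfl

theorem config_ext {A : Type*} {x y : Config 2 A} (h : ∀ a b, x ![a, b] = y ![a, b]) : x = y := by
  funext m
  rw [eq_cons m]
  exact h _ _

namespace ErosionCA

/-! ## The local rule in coordinates -/

/-- The `3 × 3` block of the configuration `z` centred at the cell `(a, b)`. -/
def block (z : Config 2 State) (a b : ℤ) : Block :=
  fun i j => z ![a + (j : ℤ) - 1, b + 1 - (i : ℤ)]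

/-- The cell `(a, b)` is in a solid state. -/
def Solid (z : Config 2 State) (a b : ℤ) : Prop := z ![a, b] ∈ Sol

instance (z : Config 2 State) (a b : ℤ) : Decidable (Solid z a b) :=
  inferInstanceAs (Decidable (_ ∈ Sol))

/-- All `3 × 3` blocks of the configuration are allowed. -/
def AllAllowed (z : Config 2 State) : Prop := ∀ a b, Allowed (block z a b)

theorem mem_Liq_iff {s : State} : s ∈ Liq ↔ s ∉ Sol := by
  revert s; decide

theorem step_apply (z : Config 2 State) (a b : ℤ) : step z ![a, b] =
    if ∃ i j : Fin 3, ¬ Allowed (block z (a + (j : ℤ) - 1) (b + 1 - (i : ℤ))) then .zero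
    else if ∃ P ∈ keepPatterns, Fits P (block z a b) then z ![a, b]
    else if ∃ P ∈ toU, Fits P (block z a b) then .U
    else if ∃ P ∈ toD, Fits P (block z a b) then .D
    else .zero := by
  have key : ∀ i j : Fin 3, sub3 (m := 3) (n := 3)
      (fun r c : Fin 5 => z (![a, b] + ![(c : ℤ) - 2, 2 - (r : ℤ)])) i j =
      block z (a + (j : ℤ) - 1) (b + 1 - (i : ℤ)) := by
    intro i j
    funext k l
    simp only [sub3, block, Matrix.cons_add_cons, Matrix.empty_add_empty]
    congr 1
    push_cast
    congr 1
    · ring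
    · congr 1; ring
  have h11 : block z (a + ((1 : Fin 3) : ℤ) - 1) (b + 1 - ((1 : Fin 3) : ℤ)) = block z a b := by
    simp
  have hc : block z a b 1 1 = z ![a, b] := by simp [block]
  simp only [step, localRule, key, h11, hc]

theorem step_congr {z z' : Config 2 State} {a b : ℤ}
    (h : ∀ i j, a - 2 ≤ i → i ≤ a + 2 → b - 2 ≤ j → j ≤ b + 2 → z ![i, j] = z' ![i, j]) :
    step z ![a, b] = step z' ![a, b] := by
  unfold step
  congr 1
  funext r c
  simp only [Matrix.cons_add_cons, Matrix.empty_add_empty]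
  apply h <;> omega

theorem isCAWithNeighbourhood_step :
    IsCAWithNeighbourhood (Finset.Icc (-2 : Fin 2 → ℤ) 2) step := by
  have hmem : ∀ r c : Fin 5, ![(c : ℤ) - 2, 2 - (r : ℤ)] ∈ Finset.Icc (-2 : Fin 2 → ℤ) 2 := by
    intro r c
    rw [Finset.mem_Icc, Pi.le_def, Pi.le_def]
    simp only [Fin.forall_fin_two]
    simp
    omega
  exact ⟨fun v => localRule fun r c => v ⟨_, hmem r c⟩, fun x m => rfl⟩

/-! ## Allowed blocks -/

/-- No entry of `obstacle` mixes liquid and solid states, so solidity is decided by the position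
alone. This is what makes allowed blocks look like windows onto a rectangle. -/
theorem obstacle_entry : ∀ (i : Fin 9) (j : Fin 10), ∀ s ∈ obstacle i j,
    (s ∈ Sol ↔ 2 ≤ (i : ℕ) ∧ (i : ℕ) ≤ 6 ∧ 3 ≤ (j : ℕ) ∧ (j : ℕ) ≤ 7) := by
  decide

theorem obstacle_liquid : ∀ (i : Fin 9) (j : Fin 10),
    ¬ (2 ≤ (i : ℕ) ∧ (i : ℕ) ≤ 6 ∧ 3 ≤ (j : ℕ) ∧ (j : ℕ) ≤ 7) →
      ∀ s ∈ Liq, s ∈ obstacle i j := by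
  decide

theorem obstacle_east : ∀ (i : Fin 9) (j : Fin 10), ∀ s ∈ obstacle i j,
    ((s = .left ∨ s = .dl ∨ s = .ul) ↔ 2 ≤ (i : ℕ) ∧ (i : ℕ) ≤ 6 ∧ (j : ℕ) = 7) := by
  decide

/-- The solid cells of an allowed block are those of the obstacle at the place of the block. -/
theorem Allowed.exists_solid_iff {b : Block} (h : Allowed b) : ∃ I J : ℕ, I < 7 ∧ J < 8 ∧
    ∀ i j : Fin 3, (b i j ∈ Sol ↔
      2 ≤ I + (i : ℕ) ∧ I + (i : ℕ) ≤ 6 ∧ 3 ≤ J + (j : ℕ) ∧ J + (j : ℕ) ≤ 7) := by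
  obtain ⟨I, J, h⟩ := h
  refine ⟨I, J, I.2, J.2, fun i j => ?_⟩
  exact obstacle_entry _ _ _ (h i j)

theorem allowed_of_liquid {b : Block} (h : ∀ i j, b i j ∉ Sol) : Allowed b := by
  refine ⟨0, 0, fun i j => ?_⟩
  have := obstacle_liquid ⟨((0 : Fin 7) : ℕ) + i, by omega⟩ ⟨((0 : Fin 8) : ℕ) + j, by omega⟩
    (by simp)
  exact this _ (mem_Liq_iff.2 (h i j))

/-- Whether a block is allowed depends on its solid states only. -/
theorem Allowed.congr {b b' : Block} (h : Allowed b)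
    (hb : ∀ i j, b' i j = b i j ∨ (b i j ∉ Sol ∧ b' i j ∉ Sol)) : Allowed b' := by
  obtain ⟨I, J, h⟩ := h
  refine ⟨I, J, fun i j => ?_⟩
  rcases hb i j with e | ⟨h1, h2⟩
  · rw [e]; exact h i j
  · have h3 := h i j
    exact obstacle_liquid _ _ (fun hc => h1 ((obstacle_entry _ _ _ h3).2 hc)) _
      (mem_Liq_iff.2 h2)

/-- The keep patterns test only solid against liquid. The bounds on `I` and `J` say that the centre
of the window is solid; the window then shows a corner, a side or the interior. -/
theorem exists_keepPattern : ∀ (I : Fin 7) (J : Fin 8),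
    1 ≤ (I : ℕ) ∧ (I : ℕ) ≤ 5 ∧ 2 ≤ (J : ℕ) ∧ (J : ℕ) ≤ 6 →
    ∃ P ∈ keepPatterns, ∀ i j : Fin 3, if 2 ≤ (I : ℕ) + (i : ℕ) ∧ (I : ℕ) + (i : ℕ) ≤ 6 ∧
      3 ≤ (J : ℕ) + (j : ℕ) ∧ (J : ℕ) + (j : ℕ) ≤ 7 then ∀ s ∈ Sol, s ∈ P i j
      else ∀ s ∈ Liq, s ∈ P i j := by
  decide

theorem Allowed.exists_keepPattern {b : Block} (h : Allowed b) (hs : b 1 1 ∈ Sol) :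
    ∃ P ∈ keepPatterns, Fits P b := by
  obtain ⟨I, J, hI, hJ, h⟩ := h.exists_solid_iff
  have h11 := (h 1 1).1 hs
  simp only [Fin.val_one] at h11
  obtain ⟨P, hP, hPs⟩ := ErosionCA.exists_keepPattern ⟨I, hI⟩ ⟨J, hJ⟩ (by simp only; omega)
  refine ⟨P, hP, fun i j => ?_⟩
  have := hPs i j
  split_ifs at this with hc
  · exact this _ ((h i j).2 hc)
  · exact this _ (mem_Liq_iff.2 fun hs => hc ((h i j).1 hs))

theorem block_center (z : Config 2 State) (a b : ℤ) : block z a b 1 1 = z ![a, b] := by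
  simp [block]

theorem block_allowed_of_near {z : Config 2 State} {a b : ℤ}
    (h : ¬ ∃ i j : Fin 3, ¬ Allowed (block z (a + (j : ℤ) - 1) (b + 1 - (i : ℤ)))) {i j : ℤ}
    (hi : a - 1 ≤ i) (hi' : i ≤ a + 1) (hj : b - 1 ≤ j) (hj' : j ≤ b + 1) :
    Allowed (block z i j) := by
  by_contra hn
  refine h ⟨⟨(b + 1 - j).toNat, by omega⟩, ⟨(i - a + 1).toNat, by omega⟩, ?_⟩
  simp only
  rwa [show a + (((i - a + 1).toNat : ℕ) : ℤ) - 1 = i by omega,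
    show b + 1 - (((b + 1 - j).toNat : ℕ) : ℤ) = j by omega]

/-- Solid states are never created, and survive only where all blocks in sight are allowed. -/
theorem solid_of_solid_step {z : Config 2 State} {a b : ℤ} (h : Solid (step z) a b) :
    step z ![a, b] = z ![a, b] ∧ ∀ i j, a - 1 ≤ i → i ≤ a + 1 → b - 1 ≤ j → j ≤ b + 1 →
      Allowed (block z i j) := by
  unfold Solid at h
  rw [step_apply] at h ⊢
  split_ifs at h ⊢ with h1 h2 h3 h4
  · exact absurd h (by decide)
  · exact ⟨rfl, fun i j hi hi' hj hj' => block_allowed_of_near h1 hi hi' hj hj'⟩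
  · exact absurd h (by decide)
  · exact absurd h (by decide)
  · exact absurd h (by decide)

theorem step_of_solid {z : Config 2 State} {a b : ℤ} (hs : Solid z a b)
    (h : ∀ i j, a - 1 ≤ i → i ≤ a + 1 → b - 1 ≤ j → j ≤ b + 1 → Allowed (block z i j)) :
    step z ![a, b] = z ![a, b] := by
  rw [step_apply, if_neg, if_pos]
  · exact (h a b (by omega) (by omega) (by omega) (by omega)).exists_keepPattern
      (by rw [block_center]; exact hs)
  · rintro ⟨i, j, hn⟩
    exact hn (h _ _ (by omega) (by omega) (by omega) (by omega))

theorem Solid.of_step {z : Config 2 State} {a b : ℤ} (h : Solid (step z) a b) : Solid z a b := by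
  have := (solid_of_solid_step h).1
  unfold Solid at h ⊢
  rwa [this] at h

theorem Solid.of_iterate {z : Config 2 State} {a b : ℤ} {n : ℕ} (h : Solid (step^[n] z) a b) :
    step^[n] z ![a, b] = z ![a, b] ∧ Solid z a b := by
  induction n with
  | zero => exact ⟨rfl, h⟩
  | succ n ih =>
    rw [Function.iterate_succ_apply'] at h ⊢
    have h2 := ih h.of_step
    exact ⟨(solid_of_solid_step h).1.trans h2.1, h2.2⟩

/-! ### Stable configurations and their frozen solid cells -/

namespace AllAllowed

variable {z : Config 2 State}

theorem step_solid (hz : AllAllowed z) {a b : ℤ} (hs : Solid z a b) :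
    step z ![a, b] = z ![a, b] :=
  step_of_solid hs fun i j _ _ _ _ => hz i j

theorem congr (hz : AllAllowed z) {z' : Config 2 State}
    (h : ∀ a b, z' ![a, b] = z ![a, b] ∨ (¬ Solid z a b ∧ ¬ Solid z' a b)) : AllAllowed z' :=
  fun a b => (hz a b).congr fun _ _ => h _ _

/-- Solid cells persist, none appears, and replacing one liquid state by another does not affect
whether a block is allowed. -/
theorem image (hz : AllAllowed z) : AllAllowed (step z) := by
  refine hz.congr fun a b => ?_
  by_cases h : Solid z a b
  · exact Or.inl (hz.step_solid h)
  · exact Or.inr ⟨h, fun h' => h h'.of_step⟩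

theorem iterate (hz : AllAllowed z) (n : ℕ) : AllAllowed (step^[n] z) := by
  induction n with
  | zero => exact hz
  | succ n ih => rw [Function.iterate_succ_apply']; exact ih.image

theorem iterate_solid (hz : AllAllowed z) {a b : ℤ} (hs : Solid z a b) (n : ℕ) :
    step^[n] z ![a, b] = z ![a, b] := by
  induction n with
  | zero => rfl
  | succ n ih =>
    rw [Function.iterate_succ_apply', (hz.iterate n).step_solid, ih]
    unfold Solid at hs ⊢
    rwa [ih]

theorem solid_iterate_iff (hz : AllAllowed z) {a b : ℤ} {n : ℕ} :
    Solid (step^[n] z) a b ↔ Solid z a b := by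
  refine ⟨fun h => h.of_iterate.2, fun h => ?_⟩
  have := hz.iterate_solid h n
  unfold Solid at h ⊢
  rwa [this]

/-- In every `3 × 3` block, the solid cells are those of a `5 × 5` box. -/
theorem exists_box (hz : AllAllowed z) (a b : ℤ) : ∃ l u : ℤ, ∀ i j, a - 1 ≤ i → i ≤ a + 1 →
    b - 1 ≤ j → j ≤ b + 1 → (Solid z i j ↔ l ≤ i ∧ i ≤ l + 4 ∧ u ≤ j ∧ j ≤ u + 4) := by
  obtain ⟨I, J, -, -, h⟩ := (hz a b).exists_solid_iff
  -- Column 3 of `obstacle` is the western side of its rectangle and row 6 the southern one; these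
  -- are their coordinates when the block occupies rows from `I` and columns from `J`.
  refine ⟨a + 2 - J, b - 5 + I, fun i j hi hi' hj hj' => ?_⟩
  have := h ⟨(b + 1 - j).toNat, by omega⟩ ⟨(i - a + 1).toNat, by omega⟩
  simp only [block] at this
  rw [show a + (((i - a + 1).toNat : ℕ) : ℤ) - 1 = i by omega,
    show b + 1 - (((b + 1 - j).toNat : ℕ) : ℤ) = j by omega] at this
  rw [Solid, this]
  omega

/-- The eastern border of an obstacle is made of arrows that have a western component. -/
theorem solid_east_iff (hz : AllAllowed z) {a b : ℤ} (hs : Solid z a b) : Solid z (a + 1) b ↔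
    ¬ (z ![a, b] = .left ∨ z ![a, b] = .dl ∨ z ![a, b] = .ul) := by
  obtain ⟨I, J, h⟩ := hz a b
  have h1 := h 1 1
  have h2 := h 1 2
  have e1 : block z a b 1 1 = z ![a, b] := block_center z a b
  have e2 : block z a b 1 2 = z ![a + 1, b] := by
    simp only [block]; congr 1; simp; ring_nf
  rw [e1] at h1
  rw [e2] at h2
  have h3 := obstacle_entry _ _ _ h1
  have h4 := obstacle_entry _ _ _ h2
  have h5 := obstacle_east _ _ _ h1
  unfold Solid at hs ⊢
  simp only [Fin.val_one, Fin.val_two] at h3 h4 h5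
  rw [h5, h4]
  have := h3.1 hs
  omega

end AllAllowed

/-! ## The motion of the particles -/

/-- The cell `(a, b)` is in state `0` or in a solid state. -/
def Calm (z : Config 2 State) (a b : ℤ) : Prop := z ![a, b] = .zero ∨ Solid z a b

theorem fits_block_iff {z : Config 2 State} {a b : ℤ} {p q r s t u v w x : Finset State} :
    Fits !![p, q, r; s, t, u; v, w, x] (block z a b) ↔
      (z ![a - 1, b + 1] ∈ p ∧ z ![a, b + 1] ∈ q ∧ z ![a + 1, b + 1] ∈ r) ∧
      (z ![a - 1, b] ∈ s ∧ z ![a, b] ∈ t ∧ z ![a + 1, b] ∈ u) ∧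
      (z ![a - 1, b - 1] ∈ v ∧ z ![a, b - 1] ∈ w ∧ z ![a + 1, b - 1] ∈ x) := by
  have h1 : a + 1 - 1 = a := by ring
  have h2 : a + 2 - 1 = a + 1 := by ring
  have h3 : b + 1 - 1 = b := by ring
  simp [Fits, Fin.forall_fin_succ, block, h2]

theorem mem_calm_iff {z : Config 2 State} {a b : ℤ} :
    z ![a, b] ∈ ({.zero} : Finset State) ∪ Sol ↔ Calm z a b := by
  simp [Calm, Solid]

theorem mem_calm_iff' {z : Config 2 State} {a b : ℤ} {s : State} :
    z ![a, b] ∈ ({.zero} : Finset State) ∪ {s} ∪ Sol ↔ (z ![a, b] = s ∨ Calm z a b) := by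
  simp [Calm, Solid]; tauto

/-- The neighbourhood of the cell `(a, b)` makes it become `U`. -/
def BecomesU (z : Config 2 State) (a b : ℤ) : Prop := ∃ P ∈ toU, Fits P (block z a b)

/-- The neighbourhood of the cell `(a, b)` makes it become `D`. -/
def BecomesD (z : Config 2 State) (a b : ℤ) : Prop := ∃ P ∈ toD, Fits P (block z a b)

/-- The disjuncts follow the order of `toU`, so that later proofs can select a pattern by its rank;
the central condition is common to all seven. -/
theorem becomesU_iff {z : Config 2 State} {a b : ℤ} : BecomesU z a b ↔ z ![a, b] = .zero ∧
    ((Calm z (a - 1) (b + 1) ∧ z ![a, b + 1] = .zero ∧ z ![a + 1, b + 1] = .zero ∧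
      Solid z (a - 1) b ∧ z ![a + 1, b] = .zero ∧
      Solid z (a - 1) (b - 1) ∧ z ![a, b - 1] = .U ∧ z ![a + 1, b - 1] = .zero) ∨
    (z ![a - 1, b + 1] = .zero ∧ z ![a, b + 1] = .zero ∧ z ![a + 1, b + 1] = .zero ∧
      z ![a - 1, b] = .zero ∧ z ![a + 1, b] = .zero ∧
      Solid z (a - 1) (b - 1) ∧ z ![a, b - 1] = .U ∧ z ![a + 1, b - 1] = .zero) ∨
    (z ![a - 1, b + 1] = .zero ∧ z ![a, b + 1] = .zero ∧ z ![a + 1, b + 1] = .zero ∧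
      z ![a - 1, b] = .zero ∧ z ![a + 1, b] = .U ∧
      Solid z (a - 1) (b - 1) ∧ Solid z a (b - 1) ∧
      (z ![a + 1, b - 1] = .D ∨ Calm z (a + 1) (b - 1))) ∨
    (z ![a - 1, b + 1] = .zero ∧ z ![a, b + 1] = .zero ∧ z ![a + 1, b + 1] = .zero ∧
      z ![a - 1, b] = .zero ∧ z ![a + 1, b] = .U ∧
      z ![a - 1, b - 1] = .zero ∧ Calm z a (b - 1) ∧ Solid z (a + 1) (b - 1)) ∨
    (z ![a - 1, b + 1] = .zero ∧ z ![a, b + 1] = .U ∧ Calm z (a + 1) (b + 1) ∧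
      z ![a - 1, b] = .zero ∧ Solid z (a + 1) b ∧
      z ![a - 1, b - 1] = .zero ∧ z ![a, b - 1] = .zero ∧ Solid z (a + 1) (b - 1)) ∨
    (z ![a - 1, b + 1] = .zero ∧ z ![a, b + 1] = .U ∧ Solid z (a + 1) (b + 1) ∧
      z ![a - 1, b] = .zero ∧ Solid z (a + 1) b ∧
      z ![a - 1, b - 1] = .zero ∧ z ![a, b - 1] = .zero ∧ z ![a + 1, b - 1] = .D) ∨
    (Calm z (a - 1) (b + 1) ∧ Calm z a (b + 1) ∧ Calm z (a + 1) (b + 1) ∧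
      Calm z (a - 1) b ∧ z ![a + 1, b] = .U ∧
      Calm z (a - 1) (b - 1) ∧ Calm z a (b - 1) ∧ z ![a + 1, b - 1] = .D)) := by
  unfold BecomesU toU
  simp only [List.mem_cons, List.not_mem_nil, or_false, exists_eq_or_imp, exists_eq_left,
    fits_block_iff, mem_calm_iff, mem_calm_iff', Finset.mem_singleton]
  have e : ∀ i j, z ![i, j] ∈ Sol ↔ Solid z i j := fun _ _ => Iff.rfl
  have aux : ∀ p q r s t u v w x : Prop, ((p ∧ q ∧ r) ∧ (s ∧ t ∧ u) ∧ (v ∧ w ∧ x)) ↔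
      (t ∧ p ∧ q ∧ r ∧ s ∧ u ∧ v ∧ w ∧ x) := by
    intros; tauto
  simp only [e, aux, ← and_or_left]

/-- Where a new particle `U` may come from. -/
theorem BecomesU.cases {z : Config 2 State} {a b : ℤ} (h : BecomesU z a b) : z ![a, b] = .zero ∧
    ((z ![a, b - 1] = .U ∧ Solid z (a - 1) (b - 1)) ∨
    (z ![a + 1, b] = .U ∧ (z ![a + 1, b - 1] = .D ∨ Solid z (a + 1) (b - 1) ∨
      (Solid z (a - 1) (b - 1) ∧ Solid z a (b - 1)))) ∨
    (z ![a, b + 1] = .U ∧ Solid z (a + 1) b ∧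
      (z ![a + 1, b - 1] = .D ∨ Solid z (a + 1) (b - 1)))) := by
  obtain ⟨h0, h⟩ := becomesU_iff.1 h
  refine ⟨h0, ?_⟩
  rcases h with h | h | h | h | h | h | h
  · exact Or.inl ⟨h.2.2.2.2.2.2.1, h.2.2.2.2.2.1⟩
  · exact Or.inl ⟨h.2.2.2.2.2.2.1, h.2.2.2.2.2.1⟩
  · exact Or.inr (Or.inl ⟨h.2.2.2.2.1, Or.inr (Or.inr ⟨h.2.2.2.2.2.1, h.2.2.2.2.2.2.1⟩)⟩)
  · exact Or.inr (Or.inl ⟨h.2.2.2.2.1, Or.inr (Or.inl h.2.2.2.2.2.2.2)⟩)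
  · exact Or.inr (Or.inr ⟨h.2.1, h.2.2.2.2.1, Or.inr h.2.2.2.2.2.2.2⟩)
  · exact Or.inr (Or.inr ⟨h.2.1, h.2.2.2.2.1, Or.inl h.2.2.2.2.2.2.2⟩)
  · exact Or.inr (Or.inl ⟨h.2.2.2.2.1, Or.inl h.2.2.2.2.2.2.2⟩)

theorem keepPatterns_center : ∀ P ∈ keepPatterns, ∀ s ∈ P 1 1, s ∈ Sol := by
  simp only [keepPatterns, rotations, List.cons_append, List.nil_append, List.forall_mem_cons,
    List.not_mem_nil, false_imp_iff, implies_true, and_true]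
  refine ⟨?_, ?_, ?_, ?_, ?_, ?_, ?_, ?_, ?_⟩ <;> decide

theorem not_fits_toU_toD : ∀ P ∈ toU, ∀ Q ∈ toD, ∃ i j, ∀ s ∈ P i j, s ∉ Q i j := by
  simp only [toU, toD, List.forall_mem_cons, List.not_mem_nil,
    false_imp_iff, implies_true, and_true]
  refine ⟨?_, ?_, ?_, ?_, ?_, ?_, ?_⟩ <;> refine ⟨?_, ?_, ?_, ?_, ?_, ?_, ?_⟩ <;> decide

theorem toD_center : ∀ P ∈ toD, ∀ s ∈ P 1 1, s = State.zero := by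
  simp only [toD, List.forall_mem_cons, List.not_mem_nil,
    false_imp_iff, implies_true, and_true]
  refine ⟨?_, ?_, ?_, ?_, ?_, ?_, ?_⟩ <;> decide

theorem BecomesU.not_becomesD {z : Config 2 State} {a b : ℤ} (h : BecomesU z a b) :
    ¬ BecomesD z a b := by
  rintro ⟨Q, hQ, hQ'⟩
  obtain ⟨P, hP, hP'⟩ := h
  obtain ⟨i, j, hd⟩ := not_fits_toU_toD P hP Q hQ
  exact hd _ (hP' i j) (hQ' i j)

theorem AllAllowed.step_of_not_solid {z : Config 2 State} (hz : AllAllowed z) {a b : ℤ}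
    (hs : ¬ Solid z a b) : step z ![a, b] = (open Classical in
      if BecomesU z a b then .U else if BecomesD z a b then .D else .zero) := by
  rw [step_apply, if_neg, if_neg]
  · simp only [BecomesU, BecomesD]
    congr
  · rintro ⟨P, hP, hf⟩
    have := hf 1 1
    rw [block_center] at this
    exact hs (keepPatterns_center P hP _ this)
  · push Not
    exact fun i j => hz _ _

theorem AllAllowed.step_eq_U_iff {z : Config 2 State} (hz : AllAllowed z) {a b : ℤ} :
    step z ![a, b] = .U ↔ BecomesU z a b := by
  by_cases hs : Solid z a b
  · rw [hz.step_solid hs]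
    unfold Solid at hs
    constructor
    · intro h; rw [h] at hs; exact absurd hs (by decide)
    · intro h; rw [(becomesU_iff.1 h).1] at hs; exact absurd hs (by decide)
  · rw [hz.step_of_not_solid hs]
    split_ifs <;> simp_all

theorem AllAllowed.step_eq_D_iff {z : Config 2 State} (hz : AllAllowed z) {a b : ℤ} :
    step z ![a, b] = .D ↔ BecomesD z a b := by
  by_cases hs : Solid z a b
  · rw [hz.step_solid hs]
    unfold Solid at hs
    constructor
    · intro h; rw [h] at hs; exact absurd hs (by decide)
    · rintro ⟨P, hP, hf⟩
      have := toD_center P hP _ (hf 1 1)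
      rw [block_center] at this
      rw [this] at hs; exact absurd hs (by decide)
  · rw [hz.step_of_not_solid hs]
    split_ifs with h1 h2
    · simp [h1.not_becomesD]
    · simp [h2]
    · simp [h2]

/-! ## The vertical reflection -/

/-- The effect of the reflection that exchanges north and south on the states. -/
def reflectState : State → State
  | .U => .D
  | .D => .U
  | .zero => .zero
  | .one => .one
  | .down => .up
  | .up => .down
  | .left => .left
  | .right => .right
  | .dl => .ul
  | .dr => .ur
  | .ul => .dl
  | .ur => .dr

theorem reflectState_reflectState (s : State) : reflectState (reflectState s) = s := by
  cases s <;> rfl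

theorem reflectState_mem_Sol {s : State} : reflectState s ∈ Sol ↔ s ∈ Sol := by
  revert s; decide

/-- The image of a configuration by the reflection that exchanges north and south. -/
def reflect (z : Config 2 State) : Config 2 State := fun m => reflectState (z ![m 0, -m 1])

theorem reflect_apply (z : Config 2 State) (a b : ℤ) :
    reflect z ![a, b] = reflectState (z ![a, -b]) := rfl

theorem reflect_reflect (z : Config 2 State) : reflect (reflect z) = z := by
  refine config_ext fun a b => ?_
  rw [reflect_apply, reflect_apply, reflectState_reflectState, neg_neg]

theorem block_reflect (z : Config 2 State) (a b : ℤ) (i j : Fin 3) :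
    block (reflect z) a b i j = reflectState (block z a (-b) (Fin.rev i) j) := by
  simp only [block, reflect_apply]
  congr 3
  rw [Fin.val_rev]
  congr 1
  omega

theorem obstacle_reflect : ∀ (i : Fin 9) (j : Fin 10), ∀ s ∈ obstacle i j,
    reflectState s ∈ obstacle (Fin.rev i) j := by
  decide

theorem allowed_reflect {z : Config 2 State} {a b : ℤ} (h : Allowed (block z a (-b))) :
    Allowed (block (reflect z) a b) := by
  obtain ⟨I, J, h⟩ := h
  refine ⟨Fin.rev I, J, fun i j => ?_⟩
  rw [block_reflect]
  have := obstacle_reflect _ _ _ (h (Fin.rev i) j)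
  rw [sub3]
  convert this using 2
  ext
  simp only [Fin.val_rev]
  omega

theorem solid_reflect {z : Config 2 State} {a b : ℤ} :
    Solid (reflect z) a b ↔ Solid z a (-b) := by
  rw [Solid, reflect_apply, reflectState_mem_Sol, Solid]

theorem AllAllowed.mirror {z : Config 2 State} (hz : AllAllowed z) :
    AllAllowed (reflect z) :=
  fun a b => allowed_reflect (hz a (-b))

theorem toU_reflect : ∀ P ∈ toU, ∃ Q ∈ toD,
    ∀ i j, ∀ s ∈ P i j, reflectState s ∈ Q (Fin.rev i) j := by
  simp only [toU, List.forall_mem_cons, List.not_mem_nil,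
    false_imp_iff, implies_true, and_true]
  refine ⟨?_, ?_, ?_, ?_, ?_, ?_, ?_⟩ <;> decide

theorem toD_reflect : ∀ P ∈ toD, ∃ Q ∈ toU,
    ∀ i j, ∀ s ∈ P i j, reflectState s ∈ Q (Fin.rev i) j := by
  simp only [toD, List.forall_mem_cons, List.not_mem_nil,
    false_imp_iff, implies_true, and_true]
  refine ⟨?_, ?_, ?_, ?_, ?_, ?_, ?_⟩ <;> decide

theorem becomesU_reflect {z : Config 2 State} {a b : ℤ} :
    BecomesU (reflect z) a b ↔ BecomesD z a (-b) := by
  constructor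
  · rintro ⟨P, hP, hf⟩
    obtain ⟨Q, hQ, h⟩ := toU_reflect P hP
    refine ⟨Q, hQ, fun i j => ?_⟩
    have := h _ _ _ (hf (Fin.rev i) j)
    rwa [block_reflect, reflectState_reflectState, Fin.rev_rev] at this
  · rintro ⟨P, hP, hf⟩
    obtain ⟨Q, hQ, h⟩ := toD_reflect P hP
    refine ⟨Q, hQ, fun i j => ?_⟩
    have := h _ _ _ (hf (Fin.rev i) j)
    rwa [Fin.rev_rev, ← block_reflect] at this

theorem becomesD_reflect {z : Config 2 State} {a b : ℤ} :
    BecomesD (reflect z) a b ↔ BecomesU z a (-b) := by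
  conv_rhs => rw [← reflect_reflect z, becomesU_reflect, neg_neg]

/-- The reflection exchanges `toU` and `toD`, and these exclude each other, so the order of the
tests in the rule does not break the symmetry. It reduces facts about `D` to facts about `U`. -/
theorem AllAllowed.step_reflect {z : Config 2 State} (hz : AllAllowed z) :
    step (reflect z) = reflect (step z) := by
  refine config_ext fun a b => ?_
  rw [reflect_apply]
  by_cases hs : Solid z a (-b)
  · rw [hz.step_solid hs, hz.mirror.step_solid (solid_reflect.2 hs), reflect_apply]
  · rw [hz.step_of_not_solid hs, hz.mirror.step_of_not_solid (mt solid_reflect.1 hs),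
      becomesU_reflect, becomesD_reflect]
    by_cases h1 : BecomesU z a (-b)
    · simp [h1, h1.not_becomesD, reflectState]
    · by_cases h2 : BecomesD z a (-b) <;> simp [h1, h2, reflectState]

theorem AllAllowed.iterate_reflect {z : Config 2 State} (hz : AllAllowed z) (n : ℕ) :
    step^[n] (reflect z) = reflect (step^[n] z) := by
  induction n with
  | zero => rfl
  | succ n ih =>
    rw [Function.iterate_succ_apply', Function.iterate_succ_apply', ih, (hz.iterate n).step_reflect]

end ErosionCA

/-! ### Maximal runs of integers -/

theorem exists_last_of_bounded {p : ℤ → Prop} {n C : ℤ} (h : p n) (hC : ∀ k, p k → k ≤ C) :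
    ∃ t, n ≤ t ∧ (∀ k, n ≤ k → k ≤ t → p k) ∧ ¬ p (t + 1) := by
  by_contra! hn
  have key : ∀ m : ℕ, ∀ k, n ≤ k → k ≤ n + m → p k := by
    intro m
    induction m with
    | zero => intro k h1 h2; rwa [show k = n by push_cast at h2; omega]
    | succ m ih =>
      intro k h1 h2
      rcases (show k ≤ n + m ∨ k = n + m + 1 by push_cast at h2; omega) with h3 | h3
      · exact ih k h1 h3
      · rw [h3]; exact hn _ (by omega) ih
  have := hC _ (key (C - n + 1).toNat (n + (C - n + 1).toNat) (by omega) le_rfl)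
  have := hC _ h
  omega

theorem exists_first_of_bounded {p : ℤ → Prop} {n C : ℤ} (h : p n) (hC : ∀ k, p k → C ≤ k) :
    ∃ t, t ≤ n ∧ (∀ k, t ≤ k → k ≤ n → p k) ∧ ¬ p (t - 1) := by
  obtain ⟨t, h1, h2, h3⟩ := exists_last_of_bounded (p := fun k => p (-k)) (n := -n) (C := -C)
    (by simpa using h) (fun k hk => by have := hC _ hk; omega)
  refine ⟨-t, by omega, fun k hk hk' => ?_, ?_⟩
  · simpa using h2 (-k) (by omega) (by omega)
  · rwa [show -t - 1 = -(t + 1) by ring]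

namespace ErosionCA

/-! ## Stable obstacles -/

/-- All nonzero states lie in the square `[-C, C]²`. -/
def SupportedIn (C : ℤ) (z : Config 2 State) : Prop :=
  ∀ a b, z ![a, b] ≠ .zero → -C ≤ a ∧ a ≤ C ∧ -C ≤ b ∧ b ≤ C

theorem Solid.ne_zero {z : Config 2 State} {a b : ℤ} (h : Solid z a b) : z ![a, b] ≠ .zero := by
  intro h0; rw [Solid, h0] at h; exact absurd h (by decide)

theorem Solid.ne_U {z : Config 2 State} {a b : ℤ} (h : Solid z a b) : z ![a, b] ≠ .U := by
  intro h0; rw [Solid, h0] at h; exact absurd h (by decide)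

theorem Solid.ne_D {z : Config 2 State} {a b : ℤ} (h : Solid z a b) : z ![a, b] ≠ .D := by
  intro h0; rw [Solid, h0] at h; exact absurd h (by decide)

/-- Configurations with finitely many solid cells are eroded to a stable one. -/
theorem exists_allAllowed_iterate {C : ℤ} {z : Config 2 State} (hz : SupportedIn C z) :
    ∃ n, AllAllowed (step^[n] z) := by
  let S : Config 2 State → Finset (ℤ × ℤ) := fun z =>
    (Finset.Icc (-C) C ×ˢ Finset.Icc (-C) C).filter fun p => Solid z p.1 p.2
  have hS : ∀ n : ℕ, ∀ z : Config 2 State, (∀ a b, Solid z a b → (a, b) ∈ S z) →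
      (S z).card = n → ∃ n, AllAllowed (step^[n] z) := by
    intro n
    induction n using Nat.strong_induction_on with
    | _ n ih =>
      intro z hz hn
      by_cases hall : AllAllowed z
      · exact ⟨0, hall⟩
      · have hsub : ∀ a b, Solid (step z) a b → (a, b) ∈ S (step z) := by
          intro a b h
          have := hz a b h.of_step
          simp only [S, Finset.mem_filter] at this ⊢
          exact ⟨this.1, h⟩
        simp only [AllAllowed, not_forall] at hall
        obtain ⟨a, b, hab⟩ := hall
        -- A forbidden block contains a solid cell. The whole block lies in the neighbourhood of
        -- that cell, which is therefore erased, so the number of solid cells strictly decreases.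
        have hex : ∃ i j, block z a b i j ∈ Sol := by
          by_contra! hc
          exact hab (allowed_of_liquid hc)
        obtain ⟨i, j, hij⟩ := hex
        have hlt : S (step z) ⊂ S z := by
          rw [Finset.ssubset_iff_of_subset]
          · refine ⟨_, hz _ _ hij, fun hc => ?_⟩
            simp only [S, Finset.mem_filter] at hc
            exact hab ((solid_of_solid_step hc.2).2 a b (by omega) (by omega) (by omega)
              (by omega))
          · intro p hp
            simp only [S, Finset.mem_filter] at hp ⊢
            exact ⟨hp.1, hp.2.of_step⟩
        obtain ⟨k, hk⟩ := ih _ (hn ▸ Finset.card_lt_card hlt) (step z) hsub rfl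
        exact ⟨k + 1, hk⟩
  refine hS _ z (fun a b h => ?_) rfl
  have := hz a b h.ne_zero
  simp only [S, Finset.mem_filter, Finset.mem_product, Finset.mem_Icc]
  exact ⟨⟨⟨this.1, this.2.1⟩, this.2.2⟩, h⟩

namespace AllAllowed

variable {z : Config 2 State}

/-- Solid sets are locally convex, in the sense of boxes. -/
theorem hull (hz : AllAllowed z) {i j i' j' : ℤ} (h : Solid z i j) (h' : Solid z i' j')
    (k l : ℤ) (hi : i ≤ i' + 2 ∧ i' ≤ i + 2) (hj : j ≤ j' + 2 ∧ j' ≤ j + 2)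
    (hk : min i i' ≤ k ∧ k ≤ max i i') (hl : min j j' ≤ l ∧ l ≤ max j j') : Solid z k l := by
  obtain ⟨x, y, hb⟩ := hz.exists_box (min i i' + 1) (min j j' + 1)
  rw [hb i j (by omega) (by omega) (by omega) (by omega)] at h
  rw [hb i' j' (by omega) (by omega) (by omega) (by omega)] at h'
  rw [hb k l (by omega) (by omega) (by omega) (by omega)]
  omega

/-- The local box is five cells wide, so it contains a horizontal neighbour of each of its cells.
This gives obstacles a width of at least two. -/
theorem solid_east_or_west (hz : AllAllowed z) {i j : ℤ} (h : Solid z i j) :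
    Solid z (i - 1) j ∨ Solid z (i + 1) j := by
  obtain ⟨x, y, hb⟩ := hz.exists_box i j
  rw [hb i j (by omega) (by omega) (by omega) (by omega)] at h
  rw [hb (i - 1) j (by omega) (by omega) (by omega) (by omega),
    hb (i + 1) j (by omega) (by omega) (by omega) (by omega)]
  omega

theorem solid_north_or_south (hz : AllAllowed z) {i j : ℤ} (h : Solid z i j) :
    Solid z i (j - 1) ∨ Solid z i (j + 1) := by
  obtain ⟨x, y, hb⟩ := hz.exists_box i j
  rw [hb i j (by omega) (by omega) (by omega) (by omega)] at h
  rw [hb i (j - 1) (by omega) (by omega) (by omega) (by omega),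
    hb i (j + 1) (by omega) (by omega) (by omega) (by omega)]
  omega

end AllAllowed

/-- The solid cells of `z` in the box `[l, r] × [u, t]` widened by two cells on each side are those
of the box itself. -/
structure IsObstacle (z : Config 2 State) (l r u t : ℤ) : Prop where
  width : l + 1 ≤ r
  height : u + 1 ≤ t
  solid_iff : ∀ i j, l - 2 ≤ i → i ≤ r + 2 → u - 2 ≤ j → j ≤ t + 2 →
    (Solid z i j ↔ l ≤ i ∧ i ≤ r ∧ u ≤ j ∧ j ≤ t)

/-- The box is spanned by the maximal vertical and horizontal solid runs through `(a, b)`. Local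
convexity (`hull`) copies the vertical run, with its two liquid ends, from column to column along
the horizontal run, and forbids other solid cells within distance two. -/
theorem AllAllowed.exists_isObstacle {z : Config 2 State} (hz : AllAllowed z) {C : ℤ}
    (hC : ∀ a b, Solid z a b → -C ≤ a ∧ a ≤ C ∧ -C ≤ b ∧ b ≤ C) {a b : ℤ} (hs : Solid z a b) :
    ∃ l r u t, IsObstacle z l r u t ∧ l ≤ a ∧ a ≤ r ∧ u ≤ b ∧ b ≤ t := by
  obtain ⟨t, hbt, ht, ht'⟩ := exists_last_of_bounded (p := Solid z a) hs
    fun k hk => (hC _ _ hk).2.2.2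
  obtain ⟨u, hub, hu, hu'⟩ := exists_first_of_bounded (p := Solid z a) hs
    fun k hk => (hC _ _ hk).2.2.1
  obtain ⟨r, har, hr, hr'⟩ := exists_last_of_bounded (p := fun k => Solid z k b) hs
    fun k hk => (hC _ _ hk).2.1
  obtain ⟨l, hla, hl, hl'⟩ := exists_first_of_bounded (p := fun k => Solid z k b) hs
    fun k hk => (hC _ _ hk).1
  have hrow : ∀ k, l ≤ k → k ≤ r → Solid z k b := by
    intro k h1 h2
    rcases le_total a k with h | h
    · exact hr k h h2
    · exact hl k h1 h
  let Col : ℤ → Prop := fun i =>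
    (∀ j, u ≤ j → j ≤ t → Solid z i j) ∧ ¬ Solid z i (u - 1) ∧ ¬ Solid z i (t + 1)
  -- One solid cell at a height of the run is enough: together with the solid neighbouring column,
  -- `hull` propagates it up and down, and a solid cell beyond an end would force one in the
  -- neighbouring column.
  have hCol : ∀ i i' k, i ≤ i' + 1 → i' ≤ i + 1 → u ≤ k → k ≤ t → Col i → Solid z i' k →
      Col i' := by
    intro i i' k h1 h2 hk hk' ⟨hc, hcu, hct⟩ hs'
    have up : ∀ m : ℕ, k + m ≤ t → Solid z i' (k + m) := by
      intro m
      induction m with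
      | zero => intro _; simpa using hs'
      | succ m ih =>
        intro hm
        push_cast at hm ⊢
        exact hz.hull (ih (by omega)) (hc (k + (m + 1)) (by omega) (by omega)) i' _
          (by omega) (by omega) (by omega) (by omega)
    have down : ∀ m : ℕ, u ≤ k - m → Solid z i' (k - m) := by
      intro m
      induction m with
      | zero => intro _; simpa using hs'
      | succ m ih =>
        intro hm
        push_cast at hm ⊢
        exact hz.hull (ih (by omega)) (hc (k - (m + 1)) (by omega) (by omega)) i' _
          (by omega) (by omega) (by omega) (by omega)
    refine ⟨fun j hj hj' => ?_, fun hn => hcu ?_, fun hn => hct ?_⟩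
    · rcases le_total k j with h | h
      · have := up (j - k).toNat (by omega)
        rwa [show k + ((j - k).toNat : ℤ) = j by omega] at this
      · have := down (k - j).toNat (by omega)
        rwa [show k - ((k - j).toNat : ℤ) = j by omega] at this
    · exact hz.hull hn (hc u (by omega) (by omega)) i (u - 1) (by omega) (by omega) (by omega)
        (by omega)
    · exact hz.hull hn (hc t (by omega) (by omega)) i (t + 1) (by omega) (by omega) (by omega)
        (by omega)
  have hCola : Col a := by
    refine ⟨fun j hj hj' => ?_, hu', ht'⟩
    rcases le_total b j with h | h
    · exact ht j h hj'
    · exact hu j hj h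
  have east : ∀ m : ℕ, a + m ≤ r → Col (a + m) := by
    intro m
    induction m with
    | zero => intro _; simpa using hCola
    | succ m ih =>
      intro hm
      push_cast at hm ⊢
      exact hCol _ _ b (by omega) (by omega) hub hbt (ih (by omega)) (hrow _ (by omega) (by omega))
  have west : ∀ m : ℕ, l ≤ a - m → Col (a - m) := by
    intro m
    induction m with
    | zero => intro _; simpa using hCola
    | succ m ih =>
      intro hm
      push_cast at hm ⊢
      exact hCol _ _ b (by omega) (by omega) hub hbt (ih (by omega)) (hrow _ (by omega) (by omega))
  have hall : ∀ i, l ≤ i → i ≤ r → Col i := by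
    intro i h1 h2
    rcases le_total a i with h | h
    · have := east (i - a).toNat (by omega)
      rwa [show a + ((i - a).toNat : ℤ) = i by omega] at this
    · have := west (a - i).toNat (by omega)
      rwa [show a - ((a - i).toNat : ℤ) = i by omega] at this
  have hsolid : ∀ i j, l - 2 ≤ i → i ≤ r + 2 → u - 2 ≤ j → j ≤ t + 2 →
      (Solid z i j ↔ l ≤ i ∧ i ≤ r ∧ u ≤ j ∧ j ≤ t) := by
    intro i j h1 h2 h3 h4
    refine ⟨fun h => ?_, fun h => (hall i h.1 h.2.1).1 j h.2.2.1 h.2.2.2⟩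
    -- Clamping gives the cell of the box nearest to `(i, j)`, at most two away in each coordinate.
    -- If `(i, j)` were solid outside the box, `hull` would give a solid cell just beyond an edge.
    have hin := (hall (max l (min i r)) (by omega) (by omega))
    have hin' := hin.1 (max u (min j t)) (by omega) (by omega)
    by_contra hn
    rcases (show r < i ∨ i < l ∨ (l ≤ i ∧ i ≤ r ∧ t < j) ∨ (l ≤ i ∧ i ≤ r ∧ j < u) by omega)
      with hc | hc | hc | hc
    · have := hz.hull h hin' (r + 1) (max u (min j t)) (by omega) (by omega) (by omega) (by omega)
      exact hr' ((hCol r (r + 1) _ (by omega) (by omega) (by omega) (by omega)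
        (hall r (by omega) le_rfl) this).1 b hub hbt)
    · have := hz.hull h hin' (l - 1) (max u (min j t)) (by omega) (by omega) (by omega) (by omega)
      exact hl' ((hCol l (l - 1) _ (by omega) (by omega) (by omega) (by omega)
        (hall l le_rfl (by omega)) this).1 b hub hbt)
    · exact hin.2.2 (hz.hull h hin' _ (t + 1) (by omega) (by omega) (by omega) (by omega))
    · exact hin.2.1 (hz.hull h hin' _ (u - 1) (by omega) (by omega) (by omega) (by omega))
  have hab := hsolid a b (by omega) (by omega) (by omega) (by omega)
  have hEW := hz.solid_east_or_west hs
  have hNS := hz.solid_north_or_south hs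
  rw [hsolid _ _ (by omega) (by omega) (by omega) (by omega),
    hsolid _ _ (by omega) (by omega) (by omega) (by omega)] at hEW hNS
  exact ⟨l, r, u, t, ⟨by omega, by omega, hsolid⟩, hla, har, hub, hbt⟩

/-! ## Particles leave to the west -/

/-- Every `U` has a predecessor `U` to the south, east or north, and the potential `a * (2 * C + 4)
+ h a b` drops by at least one along such a move. A climb happens on an eastern face, where `h` is
`-b`, and a descent on a western face, where `h` is `b`. A move west gains `2 * C + 4`, more than
the total range `2 * C + 2` of `h`. -/
theorem AllAllowed.U_escapes {z : Config 2 State} (hz : AllAllowed z) {C : ℤ} (hC0 : 0 ≤ C)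
    (hC : SupportedIn C z) (K : ℤ) :
    ∃ N : ℕ, ∀ n ≥ N, ∀ a b, -K ≤ a → step^[n] z ![a, b] ≠ .U := by
  let h : ℤ → ℤ → ℤ := fun a b => if Solid z (a - 1) b ∨ Solid z (a - 1) (b - 1) then -b else b
  have hh : ∀ a b, -(C + 1) ≤ b → b ≤ C + 1 → -(C + 1) ≤ h a b ∧ h a b ≤ C + 1 := by
    intro a b h1 h2
    simp only [h]
    split_ifs <;> omega
  have hS : ∀ a b, Solid z a b → -C ≤ a ∧ a ≤ C ∧ -C ≤ b ∧ b ≤ C := fun a b hs => hC a b hs.ne_zero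
  have key : ∀ n : ℕ, ∀ a b, step^[n] z ![a, b] = .U → (-(C + 1) ≤ b ∧ b ≤ C + 1) ∧
      a * (2 * C + 4) + h a b ≤ C * (2 * C + 4) + (C + 1) - n := by
    intro n
    induction n with
    | zero =>
      intro a b hab
      have h1 := hC a b (by rw [Function.iterate_zero_apply] at hab; simp [hab])
      have h2 := hh a b (by omega) (by omega)
      refine ⟨by omega, ?_⟩
      have : a * (2 * C + 4) ≤ C * (2 * C + 4) := mul_le_mul_of_nonneg_right (by omega) (by omega)
      push_cast
      omega
    | succ n ih =>
      intro a b hab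
      rw [Function.iterate_succ_apply', (hz.iterate n).step_eq_U_iff] at hab
      obtain ⟨h0, hab⟩ := hab.cases
      simp only [hz.solid_iterate_iff] at hab
      have hns : ¬ Solid z a b := fun hs => ((hz.solid_iterate_iff (n := n)).2 hs).ne_zero h0
      push_cast
      rcases hab with ⟨hU, hs⟩ | ⟨hU, -⟩ | ⟨hU, hs, -⟩
      · have h1 := hS _ _ hs
        have h2 := (ih _ _ hU).2
        have e1 : h a (b - 1) = -(b - 1) := if_pos (Or.inl hs)
        have e2 : h a b = -b := if_pos (Or.inr hs)
        rw [e1] at h2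
        rw [e2]
        omega
      · obtain ⟨h1, h2⟩ := ih _ _ hU
        have h3 := hh (a + 1) b h1.1 h1.2
        have h4 := hh a b h1.1 h1.2
        rw [show (a + 1) * (2 * C + 4) = a * (2 * C + 4) + (2 * C + 4) by ring] at h2
        omega
      · have h1 := hS _ _ hs
        have h2 := (ih _ _ hU).2
        -- The liquid cell `(a, b)` has a solid eastern neighbour; a solid cell on its western side
        -- would make it solid by `hull`, so `h` is not in its eastern-face regime.
        have e1 : h a (b + 1) = b + 1 := by
          refine if_neg ?_
          rintro (hc | hc)
          · exact hns (hz.hull hc hs a b (by omega) (by omega) (by omega) (by omega))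
          · exact hns (hz.hull hc hs a b (by omega) (by omega) (by omega) (by omega))
        have e2 : h a b = b := by
          refine if_neg ?_
          rintro (hc | hc)
          · exact hns (hz.hull hc hs a b (by omega) (by omega) (by omega) (by omega))
          · exact hns (hz.hull hc hs a b (by omega) (by omega) (by omega) (by omega))
        rw [e1] at h2
        rw [e2]
        omega
  -- East of `-K` the potential is at least `-K * (2 * C + 4) - (C + 1)`; from this time on, its
  -- upper bound is smaller.
  refine ⟨(C * (2 * C + 4) + (C + 1) + K * (2 * C + 4) + (C + 1) + 1).toNat,
    fun n hn a b ha hU => ?_⟩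
  obtain ⟨h1, h2⟩ := key n a b hU
  have h3 := hh a b h1.1 h1.2
  have h4 : -K * (2 * C + 4) ≤ a * (2 * C + 4) := mul_le_mul_of_nonneg_right ha (by omega)
  rw [neg_mul] at h4
  omega

theorem SupportedIn.reflect {z : Config 2 State} {C : ℤ} (hC : SupportedIn C z) :
    SupportedIn C (reflect z) := by
  intro a b h
  have := hC a (-b) fun h0 => h (by rw [reflect_apply, h0]; rfl)
  omega

theorem AllAllowed.D_escapes {z : Config 2 State} (hz : AllAllowed z) {C : ℤ} (hC0 : 0 ≤ C)
    (hC : SupportedIn C z) (K : ℤ) :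
    ∃ N : ℕ, ∀ n ≥ N, ∀ a b, -K ≤ a → step^[n] z ![a, b] ≠ .D := by
  obtain ⟨N, hN⟩ := hz.mirror.U_escapes hC0 hC.reflect K
  refine ⟨N, fun n hn a b ha hD => hN n hn a (-b) ha ?_⟩
  rw [hz.iterate_reflect, reflect_apply, neg_neg, hD]
  rfl

/-! ## The journey of a pair of particles -/

/-- The configuration `z` with a particle `U` added in `(a, b)` and a particle `D` in `(c, d)`. -/
def place (z : Config 2 State) (a b c d : ℤ) : Config 2 State :=
  fun m => if m = ![a, b] then .U else if m = ![c, d] then .D else z m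

theorem place_apply (z : Config 2 State) (a b c d i j : ℤ) : place z a b c d ![i, j] =
    if i = a ∧ j = b then .U else if i = c ∧ j = d then .D else z ![i, j] := by
  simp [place]

theorem reflect_place {z : Config 2 State} {a b c d : ℤ} (h : ¬ (a = c ∧ b = d)) :
    reflect (place z a b c d) = place (reflect z) c (-d) a (-b) := by
  refine config_ext fun i j => ?_
  rw [reflect_apply, place_apply, place_apply, reflect_apply]
  split_ifs <;> first | rfl | omega

/-- The configuration `z` has no particle. -/
def IsCalm (z : Config 2 State) : Prop := ∀ a b, Calm z a b

theorem IsCalm.reflect {z : Config 2 State} (hz : IsCalm z) : IsCalm (reflect z) := by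
  intro a b
  rcases hz a (-b) with h | h
  · left; rw [reflect_apply, h]; rfl
  · right; exact solid_reflect.2 h

theorem AllAllowed.step_eq_self {z : Config 2 State} (hz : AllAllowed z) (hc : IsCalm z) :
    step z = z := by
  refine config_ext fun a b => ?_
  by_cases hs : Solid z a b
  · exact hz.step_solid hs
  · have hU : ∀ i j, z ![i, j] ≠ .U := by
      intro i j h
      rcases hc i j with h' | h'
      · simp [h] at h'
      · exact h'.ne_U h
    have hD : ∀ i j, z ![i, j] ≠ .D := by
      intro i j h
      rcases hc i j with h' | h'
      · simp [h] at h'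
      · exact h'.ne_D h
    have hnU : ∀ z', AllAllowed z' → (∀ i j, z' ![i, j] ≠ .U) → ∀ i j, ¬ BecomesU z' i j := by
      intro z' _ hU i j h
      have := h.cases.2
      simp [hU] at this
    rw [hz.step_of_not_solid hs, if_neg (hnU z hz hU _ _), if_neg, (hc a b).resolve_right hs]
    rw [show b = - -b by ring, ← becomesU_reflect]
    refine hnU _ hz.mirror (fun i j h => hD i (-j) ?_) _ _
    rw [reflect_apply] at h
    rw [← reflectState_reflectState (z ![i, -j]), h]
    rfl

section place

variable {z : Config 2 State} {a b c d : ℤ}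

theorem solid_place_iff (hab : ¬ Solid z a b) (hcd : ¬ Solid z c d) {i j : ℤ} :
    Solid (place z a b c d) i j ↔ Solid z i j := by
  rw [Solid, place_apply]
  split_ifs with h1 h2
  · obtain ⟨rfl, rfl⟩ := h1
    exact iff_of_false (by decide) hab
  · obtain ⟨rfl, rfl⟩ := h2
    exact iff_of_false (by decide) hcd
  · rfl

theorem place_eq_zero_iff (hc : IsCalm z) {i j : ℤ} : place z a b c d ![i, j] = .zero ↔
    ¬ (i = a ∧ j = b) ∧ ¬ (i = c ∧ j = d) ∧ ¬ Solid z i j := by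
  rw [place_apply]
  split_ifs with h1 h2
  · simp [h1]
  · simp [h2]
  · have : z ![i, j] = .zero ↔ ¬ Solid z i j :=
      ⟨fun h hs => hs.ne_zero h, fun h => (hc i j).resolve_right h⟩
    rw [this]
    tauto

theorem place_eq_U_iff (hc : IsCalm z) {i j : ℤ} : place z a b c d ![i, j] = .U ↔
    i = a ∧ j = b := by
  rw [place_apply]
  split_ifs with h1 h2
  · simp [h1]
  · simp [h1]
  · refine iff_of_false (fun h => ?_) h1
    rcases hc i j with h' | h'
    · simp [h] at h'
    · exact h'.ne_U h

theorem place_eq_D_iff (hc : IsCalm z) (hne : ¬ (a = c ∧ b = d)) {i j : ℤ} :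
    place z a b c d ![i, j] = .D ↔ i = c ∧ j = d := by
  rw [place_apply]
  split_ifs with h1 h2
  · refine iff_of_false (by simp) ?_
    rintro ⟨rfl, rfl⟩
    exact hne ⟨h1.1.symm, h1.2.symm⟩
  · simp [h2]
  · refine iff_of_false (fun h => ?_) h2
    rcases hc i j with h' | h'
    · simp [h] at h'
    · exact h'.ne_D h

theorem calm_place_iff (hc : IsCalm z) (hab : ¬ Solid z a b) (hcd : ¬ Solid z c d) {i j : ℤ} :
    Calm (place z a b c d) i j ↔ ¬ (i = a ∧ j = b) ∧ ¬ (i = c ∧ j = d) := by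
  rw [Calm, place_eq_zero_iff hc, solid_place_iff hab hcd]
  have h1 : Solid z i j → ¬ (i = a ∧ j = b) := by rintro h ⟨rfl, rfl⟩; exact hab h
  have h2 : Solid z i j → ¬ (i = c ∧ j = d) := by rintro h ⟨rfl, rfl⟩; exact hcd h
  tauto

theorem AllAllowed.place (hz : AllAllowed z) (hab : ¬ Solid z a b) (hcd : ¬ Solid z c d) :
    AllAllowed (place z a b c d) := by
  refine hz.congr fun i j => ?_
  by_cases h1 : i = a ∧ j = b
  · obtain ⟨rfl, rfl⟩ := h1
    exact Or.inr ⟨hab, mt (solid_place_iff hab hcd).1 hab⟩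
  · by_cases h2 : i = c ∧ j = d
    · obtain ⟨rfl, rfl⟩ := h2
      exact Or.inr ⟨hcd, mt (solid_place_iff hab hcd).1 hcd⟩
    · left; rw [place_apply, if_neg h1, if_neg h2]

/-- The two particles can be followed separately. -/
theorem step_place (hz : AllAllowed z) (hc : IsCalm z) {a' b' c' d' : ℤ}
    (hab : ¬ Solid z a b) (hcd : ¬ Solid z c d)
    (hU : ∀ i j, BecomesU (ErosionCA.place z a b c d) i j ↔ i = a' ∧ j = b')
    (hD : ∀ i j, BecomesD (ErosionCA.place z a b c d) i j ↔ i = c' ∧ j = d') :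
    step (ErosionCA.place z a b c d) = ErosionCA.place z a' b' c' d' := by
  refine config_ext fun i j => ?_
  have hP := hz.place hab hcd
  rw [place_apply]
  by_cases hs : Solid z i j
  · have hs' := (solid_place_iff hab hcd).2 hs
    rw [hP.step_solid hs', if_neg, if_neg, place_apply, if_neg, if_neg]
    · rintro ⟨rfl, rfl⟩; exact hcd hs
    · rintro ⟨rfl, rfl⟩; exact hab hs
    · rw [← hD, ← hP.step_eq_D_iff, hP.step_solid hs']; exact hs'.ne_D
    · rw [← hU, ← hP.step_eq_U_iff, hP.step_solid hs']; exact hs'.ne_U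
  · rw [hP.step_of_not_solid (mt (solid_place_iff hab hcd).1 hs), (hc i j).resolve_right hs]
    simp only [hU, hD]

end place

/-- The configuration `z` with a pair of particles, `D` in `(x, y)` and `U` just above. -/
def pair (z : Config 2 State) (x y : ℤ) : Config 2 State := place z x (y + 1) x y

theorem becomesU_pair_iff {z : Config 2 State} (hc : IsCalm z) {x y : ℤ}
    (h1 : ¬ Solid z (x + 1) y) (h2 : ¬ Solid z (x + 1) (y + 1))
    (h4 : ¬ Solid z x (y + 1)) (i j : ℤ) :
    BecomesU (place z (x + 1) (y + 1) (x + 1) y) i j ↔ i = x ∧ j = y + 1 := by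
  constructor
  · intro h
    obtain ⟨h0, h⟩ := h.cases
    rw [place_eq_zero_iff hc] at h0
    simp only [place_eq_U_iff hc, solid_place_iff h2 h1] at h
    rcases h with ⟨h, hs⟩ | ⟨h, -⟩ | ⟨h, -⟩
    · rw [show i - 1 = x by omega, show j - 1 = y + 1 by omega] at hs
      exact absurd hs h4
    · omega
    · omega
  · rintro ⟨rfl, rfl⟩
    rw [becomesU_iff]
    simp only [place_eq_U_iff hc, place_eq_D_iff hc (show ¬ (i + 1 = i + 1 ∧ y + 1 = y) by omega),
      calm_place_iff hc h2 h1, place_eq_zero_iff hc]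
    refine ⟨⟨by omega, by omega, h4⟩, ?_⟩
    -- The last pattern of `toU`: `U` to the east, `D` to the south-east.
    iterate 6 right
    refine ⟨?_, ?_, ?_, ?_, ⟨trivial, trivial⟩, ?_, ?_, trivial, ?_⟩ <;> omega

/-- In a liquid environment, a pair moves to the west. -/
theorem step_pair {z : Config 2 State} (hz : AllAllowed z) (hc : IsCalm z) {x y : ℤ}
    (h1 : ¬ Solid z (x + 1) y) (h2 : ¬ Solid z (x + 1) (y + 1)) (h3 : ¬ Solid z x y)
    (h4 : ¬ Solid z x (y + 1)) : step (pair z (x + 1) y) = pair z x y := by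
  refine step_place hz hc h2 h1 (becomesU_pair_iff hc h1 h2 h4) fun i j => ?_
  rw [show j = - -j by ring, ← becomesU_reflect, reflect_place (by omega)]
  have := becomesU_pair_iff (x := x) (y := -(y + 1)) hc.reflect (by rw [solid_reflect]; simpa)
    (by rw [solid_reflect]; simpa) (by rw [solid_reflect]; simpa) i (-j)
  rw [show -(y + 1) + 1 = -y by ring] at this
  rw [this]
  omega

/-- The place of the particle `U` on its way around the obstacle `[l, r] × [u, t]`, when `α` steps
remain until it forms a pair with a particle `D` in `(l - 1, y)`. -/
def OnU (l r t y α a b : ℤ) : Prop :=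
  (α ≤ t - y ∧ a = l - 1 ∧ b = y + 1 + α) ∨
  (t - y < α ∧ α ≤ t - y + (r - l + 2) ∧ a = l - 1 + (α - (t - y)) ∧ b = t + 1) ∨
  (t - y + (r - l + 2) < α ∧ a = r + 1 ∧ b = t + 1 - (α - (t - y) - (r - l + 2)))

/-- The place of the particle `D`; see `OnU`. -/
def OnD (l r u y α c d : ℤ) : Prop := OnU l r (-u) (-y - 1) α c (-d)

theorem exists_onU (l r t y α : ℤ) : ∃ a b, OnU l r t y α a b := by
  by_cases h1 : α ≤ t - y
  · exact ⟨_, _, Or.inl ⟨h1, rfl, rfl⟩⟩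
  · by_cases h2 : α ≤ t - y + (r - l + 2)
    · exact ⟨_, _, Or.inr (Or.inl ⟨by omega, h2, rfl, rfl⟩)⟩
    · exact ⟨_, _, Or.inr (Or.inr ⟨by omega, rfl, rfl⟩)⟩

theorem IsObstacle.reflect {z : Config 2 State} {l r u t : ℤ} (h : IsObstacle z l r u t) :
    IsObstacle (reflect z) l r (-t) (-u) := by
  refine ⟨h.width, by have := h.height; omega, fun i j h1 h2 h3 h4 => ?_⟩
  rw [solid_reflect, h.solid_iff _ _ h1 h2 (by omega) (by omega)]
  omega

/-- Only `U` needs to be followed: `OnD` is `OnU` for the mirrored obstacle. The position of `D`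
matters at the corners, where the two particles can be adjacent. -/
theorem becomesU_around {z : Config 2 State} (hc : IsCalm z) {l r u t : ℤ}
    (ho : IsObstacle z l r u t) {y α a b c d a' b' : ℤ} (hy : u - 1 ≤ y) (hy' : y ≤ t)
    (h0 : 0 ≤ α) (hN : α < t - u + 1 + (r - l + 2)) (hU : OnU l r t y (α + 1) a b)
    (hU' : OnU l r t y α a' b') (hD : OnD l r u y (α + 1) c d) (i j : ℤ) :
    BecomesU (place z a b c d) i j ↔ i = a' ∧ j = b' := by
  have hw := ho.width
  have hh := ho.height
  unfold OnD at hD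
  unfold OnU at hU hU' hD
  have hab : ¬ Solid z a b := by
    rw [ho.solid_iff _ _ (by omega) (by omega) (by omega) (by omega)]; omega
  have hcd : ¬ Solid z c d := by
    rw [ho.solid_iff _ _ (by omega) (by omega) (by omega) (by omega)]; omega
  have hne : ¬ (a = c ∧ b = d) := by omega
  constructor
  · intro h
    obtain ⟨hz0, h⟩ := h.cases
    rw [place_eq_zero_iff hc] at hz0
    simp only [place_eq_U_iff hc, solid_place_iff hab hcd, place_eq_D_iff hc hne] at h
    have hn := hz0.2.2
    clear hz0
    rcases h with ⟨⟨rfl, h⟩, hs⟩ | ⟨⟨h, rfl⟩, hs⟩ | ⟨⟨rfl, h⟩, hs, -⟩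
    · obtain rfl : j = b + 1 := by omega
      rw [ho.solid_iff _ _ (by omega) (by omega) (by omega) (by omega)] at hs
      clear hab hcd hne hn hD
      omega
    · obtain rfl : a = i + 1 := by omega
      rw [ho.solid_iff _ _ (by omega) (by omega) (by omega) (by omega)] at hn
      rcases hs with ⟨rfl, hs⟩ | hs | ⟨hs, hs'⟩
      · clear hab hcd hne
        omega
      · rw [ho.solid_iff _ _ (by omega) (by omega) (by omega) (by omega)] at hs
        clear hab hcd hne hD
        omega
      · rw [ho.solid_iff _ _ (by omega) (by omega) (by omega) (by omega)] at hs'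
        clear hab hcd hne hD hs
        omega
    · obtain rfl : b = j + 1 := by omega
      rw [ho.solid_iff _ _ (by omega) (by omega) (by omega) (by omega)] at hs hn
      clear hab hcd hne hD
      omega
  · rintro ⟨rfl, rfl⟩
    rw [becomesU_iff]
    simp only [place_eq_U_iff hc, place_eq_D_iff hc hne, calm_place_iff hc hab hcd,
      place_eq_zero_iff hc, solid_place_iff hab hcd]
    clear hab hcd hne
    have hi : l - 1 ≤ i ∧ i ≤ r + 1 ∧ u ≤ j ∧ j ≤ t + 1 := by omega
    refine ⟨⟨?_, ?_, ?_⟩, ?_⟩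
    · omega
    · omega
    · rw [ho.solid_iff _ _ (by omega) (by omega) (by omega) (by omega)]
      omega
    rcases hU with ⟨g, ha, hb⟩ | ⟨g, g', ha, hb⟩ | ⟨g, ha, hb⟩
    · have e : i = l - 1 ∧ j = y + 1 + α := by omega
      clear hU'
      iterate 4 right
      -- When `j = u`, necessarily `y = u - 1` and `α = 0`: the pair forms again at the
      -- south-western corner, and the south-eastern neighbour is `D` in `(l, u - 1)` instead of a
      -- solid cell.
      by_cases hju : j = u
      · right; left
        simp (disch := omega) only [ho.solid_iff]
        refine ⟨?_, ?_, ?_, ?_, ?_, ?_, ?_, ?_⟩ <;> omega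
      · left
        simp (disch := omega) only [ho.solid_iff]
        refine ⟨?_, ?_, ?_, ?_, ?_, ?_, ?_, ?_⟩ <;> omega
    · have e : i = a - 1 ∧ j = t + 1 := by omega
      clear hU'
      right; right
      by_cases hil : i ≤ l
      · right; left
        simp (disch := omega) only [ho.solid_iff]
        refine ⟨?_, ?_, ?_, ?_, ?_, ?_, ?_, ?_⟩ <;> omega
      · left
        simp (disch := omega) only [ho.solid_iff]
        refine ⟨?_, ?_, ?_, ?_, ?_, ?_, ?_, ?_⟩ <;> omega
    · have e : i = r + 1 ∧ j = b + 1 := by omega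
      clear hU'
      by_cases hjt : j = t + 1
      · right; left
        simp (disch := omega) only [ho.solid_iff]
        refine ⟨?_, ?_, ?_, ?_, ?_, ?_, ?_, ?_⟩ <;> omega
      · left
        simp (disch := omega) only [ho.solid_iff]
        refine ⟨?_, ?_, ?_, ?_, ?_, ?_, ?_, ?_⟩ <;> omega

theorem step_around {z : Config 2 State} (hz : AllAllowed z) (hc : IsCalm z) {l r u t : ℤ}
    (ho : IsObstacle z l r u t) {y α a b c d a' b' c' d' : ℤ} (hy : u - 1 ≤ y) (hy' : y ≤ t)
    (h0 : 0 ≤ α) (hN : α < t - u + 1 + (r - l + 2)) (hU : OnU l r t y (α + 1) a b)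
    (hU' : OnU l r t y α a' b') (hD : OnD l r u y (α + 1) c d) (hD' : OnD l r u y α c' d') :
    step (place z a b c d) = place z a' b' c' d' := by
  have hw := ho.width
  have hh := ho.height
  have hUu := hU
  have hDu := hD
  unfold OnD at hDu
  unfold OnU at hUu hDu
  have hab : ¬ Solid z a b := by
    rw [ho.solid_iff _ _ (by omega) (by omega) (by omega) (by omega)]; omega
  have hcd : ¬ Solid z c d := by
    rw [ho.solid_iff _ _ (by omega) (by omega) (by omega) (by omega)]; omega
  refine step_place hz hc hab hcd (becomesU_around hc ho hy hy' h0 hN hU hU' hD) fun i j => ?_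
  rw [show j = - -j by ring, ← becomesU_reflect, reflect_place (by omega),
    becomesU_around (y := -y - 1) (α := α) hc.reflect ho.reflect (by omega) (by omega) h0
      (by omega) hD hD' (by rw [OnD]; convert hU using 1 <;> ring)]
  omega

/-- A pair that meets an obstacle on its eastern side goes around it: it is formed again on the
western side, at the symmetric height. -/
theorem iterate_pair_around {z : Config 2 State} (hz : AllAllowed z) (hc : IsCalm z)
    {l r u t : ℤ} (ho : IsObstacle z l r u t) {y : ℤ} (hy : u - 1 ≤ y) (hy' : y ≤ t) :
    ∃ s, step^[s] (pair z (r + 1) (t + u - 1 - y)) = pair z (l - 1) y := by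
  have hw := ho.width
  have hh := ho.height
  -- The tour is built backwards from its end. From a pair at height `y'`, `U` needs `(t - y') + (r
  -- - l + 2) + (t - y)` steps and `D` needs `(y' - u + 1) + (r - l + 2) + (y - u + 1)`; these agree
  -- exactly when `y' = t + u - 1 - y`.
  have key : ∀ α : ℕ, (α : ℤ) ≤ t - u + 1 + (r - l + 2) → ∃ a b c d, OnU l r t y α a b ∧
      OnD l r u y α c d ∧ step^[α] (place z a b c d) = pair z (l - 1) y := by
    intro α
    induction α with
    | zero =>
      intro _
      refine ⟨l - 1, y + 1, l - 1, y, Or.inl ⟨by push_cast; omega, rfl, by simp⟩,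
        Or.inl ⟨by push_cast; omega, rfl, by push_cast; omega⟩, rfl⟩
    | succ α ih =>
      intro hα
      push_cast at hα ⊢
      obtain ⟨a', b', c', d', hU', hD', e⟩ := ih (by omega)
      obtain ⟨a, b, hU⟩ := exists_onU l r t y (α + 1)
      obtain ⟨c, d, hD⟩ := exists_onU l r (-u) (-y - 1) (α + 1)
      have hD : OnD l r u y (α + 1) c (-d) := by rwa [OnD, neg_neg]
      refine ⟨a, b, c, -d, hU, hD, ?_⟩
      rw [Function.iterate_succ_apply,
        step_around hz hc ho hy hy' (by omega) (by omega) hU hU' hD hD', e]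
  obtain ⟨a, b, c, d, hU, hD, e⟩ := key (t - u + 1 + (r - l + 2)).toNat (by omega)
  refine ⟨(t - u + 1 + (r - l + 2)).toNat, ?_⟩
  rw [← e]
  unfold OnD at hD
  unfold OnU at hU hD
  generalize hn : (((t - u + 1 + (r - l + 2)).toNat : ℕ) : ℤ) = n at hU hD
  rw [pair, show a = r + 1 by omega, show b = t + u - 1 - y + 1 by omega, show c = r + 1 by omega,
    show d = t + u - 1 - y by omega]

/-- Every pair of liquid cells is reached by a pair of particles that starts far in the east. -/
theorem exists_iterate_pair {z : Config 2 State} (hz : AllAllowed z) (hc : IsCalm z) {C X : ℤ}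
    (hC : ∀ a b, Solid z a b → -C ≤ a ∧ a ≤ C ∧ -C ≤ b ∧ b ≤ C) (hX : C < X) (k : ℕ) :
    ∀ x y, x + k = X → ¬ Solid z x y → ¬ Solid z x (y + 1) →
      ∃ y' s, step^[s] (pair z X y') = pair z x y := by
  induction k using Nat.strong_induction_on with
  | _ k ih =>
    intro x y hk h1 h2
    rcases Nat.eq_zero_or_pos k with rfl | hpos
    · exact ⟨y, 0, by rw [← hk]; simp⟩
    · by_cases hs : Solid z (x + 1) y ∨ Solid z (x + 1) (y + 1)
      · have hex : ∃ v, (v = y ∨ v = y + 1) ∧ Solid z (x + 1) v := by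
          rcases hs with hs | hs
          · exact ⟨_, Or.inl rfl, hs⟩
          · exact ⟨_, Or.inr rfl, hs⟩
        obtain ⟨v, hv, hs⟩ := hex
        obtain ⟨l, r, u, t, ho, h3, h4, h5, h6⟩ := hz.exists_isObstacle hC hs
        have hl : l = x + 1 := by
          have : ¬ Solid z x v := by rcases hv with rfl | rfl <;> assumption
          rw [ho.solid_iff _ _ (by omega) (by omega) (by omega) (by omega)] at this
          omega
        obtain ⟨s, e⟩ := iterate_pair_around hz hc ho (y := y) (by omega) (by omega)
        have hrX : r ≤ C := by
          refine (hC r v ?_).2.1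
          rw [ho.solid_iff _ _ (by omega) (by omega) (by omega) (by omega)]
          omega
        -- Tracing back around the obstacle jumps over its whole width, hence the strong induction;
        -- column `r + 1` does not pass `X` because `r ≤ C < X`.
        obtain ⟨y', s', e'⟩ := ih (X - (r + 1)).toNat (by omega) (r + 1) (t + u - 1 - y)
          (by omega)
          (by rw [ho.solid_iff _ _ (by omega) (by omega) (by omega) (by omega)]; omega)
          (by rw [ho.solid_iff _ _ (by omega) (by omega) (by omega) (by omega)]; omega)
        refine ⟨y', s + s', ?_⟩
        rw [Function.iterate_add_apply, e', e, hl]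
        congr 1
        ring
      · rw [not_or] at hs
        obtain ⟨y', s, e⟩ := ih (k - 1) (by omega) (x + 1) y (by omega) hs.1 hs.2
        exact ⟨y', s + 1, by rw [Function.iterate_succ_apply', e, step_pair hz hc hs.1 hs.2 h1 h2]⟩

/-! ## Sensitivity fails inside large obstacles -/

/-- The position of a coordinate with respect to the interval `[-(k + 1), k + 1]`: outside (`0`),
at the lower end (`1`), inside (`2`), at the upper end (`3`). -/
def zone (k a : ℤ) : Fin 4 :=
  if a = -(k + 1) then 1 else if -k ≤ a ∧ a ≤ k then 2 else if a = k + 1 then 3 else 0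

/-- The state in a square obstacle, in terms of the zones of the two coordinates. -/
def zoneState (p q : Fin 4) : State :=
  !![.zero, .zero, .zero, .zero;
     .zero, .ur, .right, .dr;
     .zero, .up, .one, .down;
     .zero, .ul, .left, .dl] p q

/-- The configuration with a single obstacle, the square `[-(k + 1), k + 1]²`. -/
def square (k : ℤ) : Config 2 State := fun m => zoneState (zone k (m 0)) (zone k (m 1))

/-- The configuration contains the obstacle `[-(k + 1), k + 1]²`, surrounded by liquid cells. -/
def HasSquare (k : ℤ) (z : Config 2 State) : Prop :=
  ∀ a b, -(k + 3) ≤ a → a ≤ k + 3 → -(k + 3) ≤ b → b ≤ k + 3 →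
    (zone k a ≠ 0 ∧ zone k b ≠ 0 → z ![a, b] = zoneState (zone k a) (zone k b)) ∧
    (zone k a = 0 ∨ zone k b = 0 → ¬ Solid z a b)

theorem hasSquare_square (k : ℤ) : HasSquare k (square k) := by
  have h0 : ∀ p q : Fin 4, p = 0 ∨ q = 0 → zoneState p q ∉ Sol := by decide
  exact fun a b _ _ _ _ => ⟨fun _ => rfl, fun h => h0 _ _ h⟩

/-- The zones of the columns of `obstacle`. -/
def columnZone (n : ℕ) : Fin 4 :=
  if n = 3 then 1 else if 4 ≤ n ∧ n ≤ 6 then 2 else if n = 7 then 3 else 0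

/-- The zones of the rows of `obstacle`. -/
def rowZone (n : ℕ) : Fin 4 :=
  if n = 6 then 1 else if 3 ≤ n ∧ n ≤ 5 then 2 else if n = 2 then 3 else 0

theorem zoneState_mem_obstacle : ∀ (i : Fin 9) (j : Fin 10), columnZone j ≠ 0 ∧ rowZone i ≠ 0 →
    ∀ s ∈ ({zoneState (columnZone j) (rowZone i)} : Finset State), s ∈ obstacle i j := by
  decide

theorem liquid_mem_obstacle : ∀ (i : Fin 9) (j : Fin 10), columnZone j = 0 ∨ rowZone i = 0 →
    ∀ s ∈ Liq, s ∈ obstacle i j := by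
  decide

/-- For `k ≥ 1`, three consecutive columns meet at most one end of the interval, and the interior of
`obstacle` is three columns wide, so `obstacle` shows every such sequence of zones. -/
theorem exists_columnZone {k i : ℤ} (hk : 1 ≤ k) (h1 : -(k + 2) ≤ i) (h2 : i ≤ k + 2) :
    ∃ J : Fin 8, ∀ d : Fin 3, zone k (i + (d : ℤ) - 1) = columnZone (J + d) := by
  rcases (show i ≤ -k ∨ k ≤ i ∨ (-k < i ∧ i < k) by omega) with h | h | h
  · refine ⟨⟨(i + k + 3).toNat, by omega⟩, fun d => ?_⟩
    have hd := d.2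
    simp only [zone, columnZone]
    split_ifs <;> first | rfl | (exfalso; omega)
  · refine ⟨⟨(i - k + 5).toNat, by omega⟩, fun d => ?_⟩
    have hd := d.2
    simp only [zone, columnZone]
    split_ifs <;> first | rfl | (exfalso; omega)
  · refine ⟨⟨4, by omega⟩, fun d => ?_⟩
    have hd := d.2
    simp only [zone, columnZone]
    split_ifs <;> first | rfl | (exfalso; omega)

theorem exists_rowZone {k j : ℤ} (hk : 1 ≤ k) (h1 : -(k + 2) ≤ j) (h2 : j ≤ k + 2) :
    ∃ I : Fin 7, ∀ d : Fin 3, zone k (j + 1 - (d : ℤ)) = rowZone (I + d) := by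
  rcases (show j ≤ -k ∨ k ≤ j ∨ (-k < j ∧ j < k) by omega) with h | h | h
  · refine ⟨⟨(4 - k - j).toNat, by omega⟩, fun d => ?_⟩
    have hd := d.2
    simp only [zone, rowZone]
    split_ifs <;> first | rfl | (exfalso; omega)
  · refine ⟨⟨(k + 2 - j).toNat, by omega⟩, fun d => ?_⟩
    have hd := d.2
    simp only [zone, rowZone]
    split_ifs <;> first | rfl | (exfalso; omega)
  · refine ⟨⟨3, by omega⟩, fun d => ?_⟩
    have hd := d.2
    simp only [zone, rowZone]
    split_ifs <;> first | rfl | (exfalso; omega)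

theorem HasSquare.allowed {k : ℤ} {z : Config 2 State} (hz : HasSquare k z) (hk : 1 ≤ k) {i j : ℤ}
    (h1 : -(k + 2) ≤ i) (h2 : i ≤ k + 2) (h3 : -(k + 2) ≤ j) (h4 : j ≤ k + 2) :
    Allowed (block z i j) := by
  obtain ⟨J, hJ⟩ := exists_columnZone hk h1 h2
  obtain ⟨I, hI⟩ := exists_rowZone hk h3 h4
  refine ⟨I, J, fun p q => ?_⟩
  have h := hz (i + (q : ℤ) - 1) (j + 1 - (p : ℤ)) (by omega) (by omega) (by omega) (by omega)
  rw [hJ, hI] at h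
  by_cases hc : columnZone (J + q) ≠ 0 ∧ rowZone (I + p) ≠ 0
  · rw [block, h.1 hc]
    exact zoneState_mem_obstacle ⟨(I : ℕ) + p, by omega⟩ ⟨(J : ℕ) + q, by omega⟩ hc _
      (Finset.mem_singleton_self _)
  · have hc' : columnZone (J + q) = 0 ∨ rowZone (I + p) = 0 := by tauto
    exact liquid_mem_obstacle ⟨(I : ℕ) + p, by omega⟩ ⟨(J : ℕ) + q, by omega⟩ hc' _
      (mem_Liq_iff.2 (h.2 hc'))

/-- The blocks seen from a cell of the square have centres with coordinates at most `k + 2` in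
absolute value, so they stay within the controlled range `k + 3` and are allowed. -/
theorem HasSquare.step {k : ℤ} {z : Config 2 State} (hz : HasSquare k z) (hk : 1 ≤ k) :
    HasSquare k (step z) := by
  intro a b h1 h2 h3 h4
  have hzone : ∀ c, zone k c ≠ 0 → -(k + 1) ≤ c ∧ c ≤ k + 1 := by
    intro c hc
    unfold zone at hc
    split_ifs at hc <;> omega
  have hsol : ∀ p q : Fin 4, p ≠ 0 ∧ q ≠ 0 → zoneState p q ∈ Sol := by decide
  refine ⟨fun h => ?_, fun h hs => (hz a b h1 h2 h3 h4).2 h hs.of_step⟩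
  have h5 := hzone _ h.1
  have h6 := hzone _ h.2
  have e := (hz a b h1 h2 h3 h4).1 h
  rw [step_of_solid _ _, e]
  · rw [Solid, e]; exact hsol _ _ h
  · exact fun i j _ _ _ _ => hz.allowed hk (by omega) (by omega) (by omega) (by omega)

theorem HasSquare.iterate {k : ℤ} {z : Config 2 State} (hz : HasSquare k z) (hk : 1 ≤ k) (n : ℕ) :
    HasSquare k (ErosionCA.step^[n] z) := by
  induction n with
  | zero => exact hz
  | succ n ih => rw [Function.iterate_succ_apply']; exact ih.step hk

theorem not_isSensitive_step : ¬ IsSensitive step := by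
  rintro ⟨ε, hε, h⟩
  obtain ⟨k, hk⟩ := exists_pow_lt_of_lt_one hε (show (1 / 2 : ℝ) < 1 by norm_num)
  -- The square of parameter `k + 1` has the state `1` on the whole window of radius `k`; the extra
  -- `3` covers its side and the liquid frame required by `HasSquare`.
  obtain ⟨y, n, hy, hn⟩ := h ((1 / 2) ^ (k + 1 + 3)) (by positivity) (square (k + 1 : ℕ))
  have hx := hasSquare_square (k + 1 : ℕ)
  have hy : HasSquare (k + 1 : ℕ) y := by
    intro a b h1 h2 h3 h4
    have e : square (k + 1 : ℕ) ![a, b] = y ![a, b] :=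
      agree_of_cantorDist_lt hy (cellNorm_le_iff.2 ⟨by omega, by omega⟩)
    have := hx a b h1 h2 h3 h4
    rw [Solid, e] at this
    exact this
  have h1 := hx.iterate (by omega) n
  have h2 := hy.iterate (by omega) n
  have := cantorDist_le_of_agree (m := k) (x := step^[n] (square (k + 1 : ℕ)))
    (y := step^[n] y) fun i hi => by
      rw [eq_cons i, cellNorm_le_iff] at hi
      rw [eq_cons i]
      have hz : ∀ c : ℤ, c.natAbs ≤ k → zone (k + 1 : ℕ) c = 2 := by
        intro c hc
        unfold zone
        rw [if_neg (by omega), if_pos (by omega)]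
      have e0 := hz _ hi.1
      have e1 := hz _ hi.2
      have hne : zone (k + 1 : ℕ) (i 0) ≠ 0 ∧ zone (k + 1 : ℕ) (i 1) ≠ 0 := by
        rw [e0, e1]; decide
      rw [(h1 _ _ (by omega) (by omega) (by omega) (by omega)).1 hne,
        (h2 _ _ (by omega) (by omega) (by omega) (by omega)).1 hne]
  have h3 : (1 / 2 : ℝ) ^ (k + 1) ≤ (1 / 2) ^ k :=
    pow_le_pow_of_le_one (by norm_num) (by norm_num) (Nat.le_succ k)
  linarith

/-! ## No equicontinuous point -/

theorem SupportedIn.step {C : ℤ} {z : Config 2 State} (hz : SupportedIn C z) :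
    SupportedIn (C + 2) (step z) := by
  intro a b h
  by_contra hn
  refine h ?_
  rw [step_congr (z' := fun _ => .zero), AllAllowed.step_eq_self]
  · exact fun a b => allowed_of_liquid fun i j => by simp only [block]; decide
  · exact fun a b => Or.inl rfl
  · intro i j _ _ _ _
    by_contra hne
    have := hz i j hne
    omega

theorem SupportedIn.iterate {C : ℤ} {z : Config 2 State} (hz : SupportedIn C z) (n : ℕ) :
    SupportedIn (C + 2 * n) (ErosionCA.step^[n] z) := by
  induction n with
  | zero => simpa using hz
  | succ n ih =>
    rw [Function.iterate_succ_apply']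
    convert ih.step using 1
    push_cast
    ring

/-- A new particle never comes from its western neighbour, so an empty eastern half-plane stays
empty. -/
theorem AllAllowed.step_eq_zero_of_east {C : ℤ} {z : Config 2 State} (hz : AllAllowed z)
    (h : ∀ a b, C < a → z ![a, b] = .zero) {a b : ℤ} (ha : C < a) : step z ![a, b] = .zero := by
  have hU : ∀ z', (∀ a b, C < a → z' ![a, b] = .zero) → ∀ b, ¬ BecomesU z' a b := by
    intro z' h b hb
    have := hb.cases.2
    simp [h _ _ ha, h _ _ (show C < a + 1 by omega)] at this
  have hs : ¬ Solid z a b := fun hs => hs.ne_zero (h a b ha)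
  rw [hz.step_of_not_solid hs, if_neg (hU z h b), if_neg]
  rw [show b = - -b by ring, ← becomesU_reflect]
  refine hU _ (fun i j hi => ?_) _
  rw [reflect_apply, h _ _ hi]
  rfl

/-- A pair that is far in the east moves independently of the rest. -/
theorem step_pair_of_east {C : ℤ} {z : Config 2 State} (h : ∀ a b, C < a → z ![a, b] = .zero)
    {x y : ℤ} (hx : C + 4 ≤ x) : step (pair z (x + 1) y) = pair (step z) x y := by
  have h0 : AllAllowed fun _ => State.zero :=
    fun a b => allowed_of_liquid fun i j => by simp only [block]; decide
  have h0c : IsCalm fun _ => State.zero := fun a b => Or.inl rfl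
  have hns : ∀ i j, ¬ Solid (fun _ => State.zero) i j := fun i j h => h.ne_zero rfl
  refine config_ext fun i j => ?_
  -- With radius two, cells up to column `x - 2` do not see the pair in column `x + 1`, and the
  -- others see only columns from `x - 3 ≥ C + 1`, where `z` is `0`.
  by_cases hi : i ≤ x - 2
  · rw [pair, pair, place_apply, if_neg (by omega), if_neg (by omega)]
    refine step_congr fun i' j' _ _ _ _ => ?_
    rw [place_apply, if_neg (by omega), if_neg (by omega)]
  · have hz : step z ![i, j] = .zero := by
      rw [step_congr (z' := fun _ => .zero), h0.step_eq_self h0c]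
      exact fun i' j' _ _ _ _ => h _ _ (by omega)
    rw [step_congr (z' := pair (fun _ => .zero) (x + 1) y),
      step_pair h0 h0c (hns _ _) (hns _ _) (hns _ _) (hns _ _), pair, pair, place_apply,
      place_apply, hz]
    intro i' j' _ _ _ _
    rw [pair, pair, place_apply, place_apply, h _ _ (by omega)]

theorem iterate_pair_of_east {C : ℤ} {z : Config 2 State}
    (h : ∀ (n : ℕ) (a b : ℤ), C < a → step^[n] z ![a, b] = .zero) (n : ℕ) :
    ∀ x y : ℤ, C + 4 ≤ x → step^[n] (pair z (x + n) y) = pair (step^[n] z) x y := by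
  induction n with
  | zero => intro x y _; simp
  | succ n ih =>
    intro x y hx
    rw [Function.iterate_succ_apply', Function.iterate_succ_apply',
      show x + ((n + 1 : ℕ) : ℤ) = x + 1 + n by push_cast; ring, ih (x + 1) y (by omega),
      step_pair_of_east (h n) hx]

theorem iterate_congr_of_east {z z' : Config 2 State} {A : ℤ}
    (h : ∀ a b, A ≤ a → z ![a, b] = z' ![a, b]) (n : ℕ) :
    ∀ a b, A + 2 * n ≤ a → step^[n] z ![a, b] = step^[n] z' ![a, b] := by
  induction n with
  | zero => intro a b ha; exact h a b (by simpa using ha)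
  | succ n ih =>
    intro a b ha
    push_cast at ha
    rw [Function.iterate_succ_apply', Function.iterate_succ_apply']
    exact step_congr fun i j _ _ _ _ => ih i j (by omega)

/-- The configuration `z` without its particles. -/
def solidPart (z : Config 2 State) : Config 2 State := fun m => if z m ∈ Sol then z m else .zero

theorem solidPart_apply (z : Config 2 State) (a b : ℤ) :
    solidPart z ![a, b] = if Solid z a b then z ![a, b] else .zero := rfl

theorem solid_solidPart {z : Config 2 State} {a b : ℤ} :
    Solid (solidPart z) a b ↔ Solid z a b := by
  rw [Solid, solidPart_apply]
  split_ifs with h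
  · rfl
  · exact iff_of_false (by decide) h

theorem isCalm_solidPart (z : Config 2 State) : IsCalm (solidPart z) := by
  intro a b
  by_cases h : Solid z a b
  · exact Or.inr (solid_solidPart.2 h)
  · left; rw [solidPart_apply, if_neg h]

theorem AllAllowed.solidPart {z : Config 2 State} (hz : AllAllowed z) :
    AllAllowed (solidPart z) := by
  refine hz.congr fun a b => ?_
  by_cases h : Solid z a b
  · left; rw [solidPart_apply, if_pos h]
  · exact Or.inr ⟨h, mt solid_solidPart.1 h⟩

/-- For every configuration `x` there is a bounded window that meets the liquid component of all
the finite stable configurations whose solid cells come from `x`. -/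
theorem exists_window (x : Config 2 State) : ∃ w : ℕ, ∀ (C : ℤ) (z : Config 2 State),
    AllAllowed z → SupportedIn C z → (∀ a b, Solid z a b → z ![a, b] = x ![a, b]) →
    ∃ k : ℕ, k ≤ w ∧ ¬ Solid z k 0 := by
  by_cases h : ∃ n : ℕ, x ![n, 0] = .left ∨ x ![n, 0] = .dl ∨ x ![n, 0] = .ul
  · obtain ⟨n, hn⟩ := h
    refine ⟨n + 1, fun C z hz _ hx => ?_⟩
    by_cases hs : Solid z n 0
    · refine ⟨n + 1, le_rfl, ?_⟩
      push_cast
      rw [hz.solid_east_iff hs, hx _ _ hs, not_not]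
      exact hn
    · exact ⟨n, by omega, hs⟩
  -- Without such an arrow, an obstacle through the origin would extend east forever, against the
  -- finite support.
  · refine ⟨0, fun C z hz hC hx => ⟨0, le_rfl, fun hs => ?_⟩⟩
    have key : ∀ n : ℕ, Solid z n 0 := by
      intro n
      induction n with
      | zero => exact hs
      | succ n ih =>
        push_cast
        rw [hz.solid_east_iff ih, hx _ _ ih]
        exact fun hc => h ⟨n, hc⟩
    have h0 := hC _ _ (key 0).ne_zero
    have := hC _ _ (key (C + 1).toNat).ne_zero
    omega

/-- A particle can be sent into every liquid cell of the obstacles that survive in a finite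
configuration, long after the configuration alone has become quiet there. -/
theorem exists_infiltration {C : ℤ} (hC0 : 0 ≤ C) {z : Config 2 State} (hz : SupportedIn C z)
    {T : ℕ} (hT : AllAllowed (step^[T] z)) {k : ℕ} (hk : ¬ Solid (step^[T] z) k 0) :
    ∃ (X y : ℤ) (n : ℕ), C < X ∧ step^[n] (pair z X y) ![k, 0] ≠ step^[n] z ![k, 0] := by
  set v := step^[T] z with hv
  set E : ℤ := C + 2 * T with hE
  have hvE : SupportedIn E v := hz.iterate T
  have hE0 : 0 ≤ E := by omega
  have hquiet : ∀ (n : ℕ) (a b : ℤ), E < a → step^[n] z ![a, b] = .zero := by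
    intro n
    rcases le_total n T with h | h
    · intro a b ha
      by_contra hne
      have := hz.iterate n a b hne
      omega
    · induction n, h using Nat.le_induction with
      | base =>
        intro a b ha
        by_contra hne
        have := hvE a b hne
        omega
      | succ n h ih =>
        intro a b ha
        rw [Function.iterate_succ_apply']
        refine AllAllowed.step_eq_zero_of_east ?_ ih ha
        rw [show n = (n - T) + T by omega, Function.iterate_add_apply]
        exact hT.iterate _
  have hB := hT.solidPart
  have hBc := isCalm_solidPart v
  have hBC : ∀ a b, Solid (solidPart v) a b → -E ≤ a ∧ a ≤ E ∧ -E ≤ b ∧ b ≤ E :=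
    fun a b h => hvE a b (solid_solidPart.1 h).ne_zero
  -- A vertical pair of liquid cells containing `(k, 0)`: if both `(k, 1)` and `(k, -1)` were solid,
  -- `hull` would make `(k, 0)` solid.
  have hy : ∃ y, (y = 0 ∨ y = -1) ∧ ¬ Solid (solidPart v) k y ∧
      ¬ Solid (solidPart v) k (y + 1) := by
    by_cases h1 : Solid v k 1
    · refine ⟨-1, Or.inr rfl, ?_, ?_⟩
      · rw [solid_solidPart]
        exact fun h2 => hk (hT.hull h1 h2 _ _ (by omega) (by omega) (by omega) (by omega))
      · rwa [solid_solidPart]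
    · exact ⟨0, Or.inl rfl, by rwa [solid_solidPart], by rwa [solid_solidPart]⟩
  obtain ⟨y, hy, hy1, hy2⟩ := hy
  obtain ⟨y', s, hs⟩ := exists_iterate_pair hB hBc (X := E + 4 + k) hBC (by omega)
    (E + 4).toNat k y (by omega) hy1 hy2
  -- The final journey takes `s` steps, during which influences travel at most `2 * s` columns; west
  -- of `-2 * s`, leftover particles cannot affect column `k`.
  obtain ⟨N₁, hN₁⟩ := hT.U_escapes hE0 hvE (2 * s)
  obtain ⟨N₂, hN₂⟩ := hT.D_escapes hE0 hvE (2 * s)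
  set n := max N₁ N₂ with hn
  have hagree : ∀ a b, -(2 * (s : ℤ)) ≤ a → step^[n] v ![a, b] = solidPart v ![a, b] := by
    intro a b ha
    rw [solidPart_apply]
    split_ifs with h
    · exact hT.iterate_solid h n
    · have h1 := hN₁ n (le_max_left _ _) a b ha
      have h2 := hN₂ n (le_max_right _ _) a b ha
      have h3 : step^[n] v ![a, b] ∉ Sol := mt hT.solid_iterate_iff.1 h
      generalize step^[n] v ![a, b] = q at h1 h2 h3
      revert q
      decide
  have e0 : step^[n] v = step^[n + T] z := by rw [Function.iterate_add_apply]
  -- The initial distance makes the pair spend `n + T` steps in the empty east while the rest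
  -- becomes quiet, and then start its journey from column `E + 4 + k`.
  refine ⟨E + 4 + k + ((n + T : ℕ) : ℤ), y', s + (n + T), by omega, ?_⟩
  rw [Function.iterate_add_apply, Function.iterate_add_apply _ s,
    iterate_pair_of_east hquiet (n + T) _ _ (by omega), ← e0,
    iterate_congr_of_east hagree s k 0 (by omega),
    iterate_congr_of_east (z' := pair (solidPart v) (E + 4 + k) y') _ s k 0
      (show -(2 * (s : ℤ)) + 2 * s ≤ k by omega),
    hs, Function.iterate_fixed (hB.step_eq_self hBc), solidPart_apply, if_neg hk, pair,
    place_apply]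
  · rcases hy with rfl | rfl <;> simp
  · intro a b ha
    rw [pair, pair, place_apply, place_apply, hagree a b ha]

theorem not_isEquicontinuousPoint_step (x : Config 2 State) : ¬ IsEquicontinuousPoint step x := by
  intro h
  obtain ⟨w, hw⟩ := exists_window x
  -- The precision comes from the window of `x`, before `δ` is known; this is why `w` must not
  -- depend on the truncation radius `m`.
  obtain ⟨δ, hδ, h⟩ := h ((1 / 2) ^ w) (by positivity)
  obtain ⟨m, hm⟩ := exists_pow_lt_of_lt_one hδ (show (1 / 2 : ℝ) < 1 by norm_num)
  have hnear : ∀ y : Config 2 State, (∀ i, cellNorm i ≤ m → x i = y i) → cantorDist x y < δ := by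
    intro y hy
    have h3 : (1 / 2 : ℝ) ^ (m + 1) ≤ (1 / 2) ^ m :=
      pow_le_pow_of_le_one (by norm_num) (by norm_num) (Nat.le_succ m)
    exact ((cantorDist_le_of_agree hy).trans h3).trans_lt hm
  let z : Config 2 State := fun i => if cellNorm i ≤ m then x i else .zero
  have hzx : ∀ i, cellNorm i ≤ m → x i = z i := fun i hi => (if_pos hi).symm
  have hz : SupportedIn m z := by
    intro a b hab
    have : cellNorm ![a, b] ≤ m := by
      by_contra hc
      exact hab (if_neg hc)
    rw [cellNorm_le_iff] at this
    omega
  obtain ⟨T, hT⟩ := exists_allAllowed_iterate hz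
  obtain ⟨k, hkw, hk⟩ := hw _ _ hT (hz.iterate T) fun a b hs => by
    rw [hs.of_iterate.1]
    have hne := hs.of_iterate.2.ne_zero
    have : cellNorm ![a, b] ≤ m := by
      by_contra hc
      exact hne (if_neg hc)
    exact (hzx _ this).symm
  obtain ⟨X, y, n, hX, hne⟩ := exists_infiltration (by omega) hz hT hk
  have hk' : cellNorm ![(k : ℤ), 0] ≤ w := cellNorm_le_iff.2 ⟨by omega, by omega⟩
  refine hne ?_
  rw [← agree_of_cantorDist_lt (h z (hnear z hzx) n) hk',
    ← agree_of_cantorDist_lt (h (pair z X y) (hnear _ fun i hi => ?_) n) hk']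
  rw [hzx i hi]
  rw [eq_cons i, cellNorm_le_iff] at hi
  rw [eq_cons i, pair, place_apply, if_neg (by omega), if_neg (by omega)]

end ErosionCA

/-! ### Failure of the dichotomy in dimension two -/

theorem mainTheorem1 :
    Fintype.card ErosionCA.State = 12 ∧
    IsCAWithNeighbourhood (Finset.Icc (-2 : Fin 2 → ℤ) 2) ErosionCA.step ∧
    (¬ ∃ x : Config 2 ErosionCA.State, IsEquicontinuousPoint ErosionCA.step x) ∧
    ¬ IsSensitive ErosionCA.step ∧
    ¬ KurkaDichotomy 2 := by
  have hE : ¬ ∃ x : Config 2 ErosionCA.State, IsEquicontinuousPoint ErosionCA.step x :=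
    fun ⟨x, hx⟩ => ErosionCA.not_isEquicontinuousPoint_step x hx
  refine ⟨rfl, ErosionCA.isCAWithNeighbourhood_step, hE, ErosionCA.not_isSensitive_step,
    fun h => ?_⟩
  rcases h ErosionCA.State ErosionCA.step ⟨_, ErosionCA.isCAWithNeighbourhood_step⟩ with h | h
  · exact hE h
  · exact ErosionCA.not_isSensitive_step h
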